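/- For a $C^*$-algebra $D$ and $a,b\in D_+$ write $a\lesssim_D b$ if there are $x_i\in D$ ($i\in\mathbb N$) with $\lim_i\|a-x_i^*bx_i\|=0$. Let $M_\infty(D)_+=\bigcup_{n}M_n(D)_+$, where $x\in M_n(D)$ is identified with $\mathrm{diag}(x,0)\in M_{n+m}(D)$, and write $a\lesssim b$ for $a,b\in M_\infty(D)_+$ if $a\lesssim_{M_n(D)}b$ for some $n$ with $a,b\in M_n(D)$ (this does not depend on $n$). The Cuntz semigroup is $W(D)=M_\infty(D)_+/\!\sim$, where $a\sim b$ means $a\lesssim b$ and $b\lesssim a$, with $\langle a\rangle+\langle b\rangle=\langle \mathrm{diag}(a,b)\rangle$ and $\langle a\rangle\le\langle b\rangle$ iff $a\lesssim b$. It is called almost unperforated if for all $\langle a\rangle,\langle b\rangle\in W(D)$ and all integers $k\ge 1$, $(k+1)\langle a\rangle\le k\langle b\rangle$ implies $\langle a\rangle\le\langle b\rangle$. Let $\mathcal P$ be a class of $C^*$-algebras. A unital simple $C^*$-algebra $A$ is asymptotically tracially in $\mathcal P$ if for every finite subset $\mathcal F\subset A$, every $\varepsilon>0$ and every $a\in A_+\setminus\{0\}$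 there are a $C^*$-algebra $B\in\mathcal P$ and completely positive contractive linear maps $\alpha:A\to B$, $\beta_n:B\to A$, $\gamma_n:A\to A$ ($n\in\mathbb N$) such that (1) $\|x-(\gamma_n(x)+\beta_n(\alpha(x)))\|<\varepsilon$ for all $x\in\mathcal F$ and all $n$; (2) $\|\alpha(xy)-\alpha(x)\alpha(y)\|<\varepsilon$ and $\big|\|\alpha(x)\|-\|x\|\big|<\varepsilon$ for all $x,y\in\mathcal F$; (3) $\lim_{n}\|\beta_n(xy)-\beta_n(x)\beta_n(y)\|=0$ and $\lim_{n}\|\beta_n(x)\|=\|x\|$ for all $x,y\in B$; (4) $\gamma_n(1_A)\lesssim_A a$ for all $n$. Theorem. Let $\mathcal W$ be the class of unital $C^*$-algebras $B$ for which $W(B)$ is almost unperforated. If $A$ is a unital simple $C^*$-algebra which is asymptotically tracially in $\mathcal W$, then $A\in\mathcal W$; that is, $W(A)$ is almost unperforated. -/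

import Mathlib

open Filter Topology
open scoped CStarAlgebra Matrix

universe u v

/-! ### Cuntz subequivalence -/

section Cuntz

/-- Cuntz subequivalence `a ≲ b` in a C⋆-algebra `D`: there are `x i ∈ D` with
`‖a - (x i)⋆ b (x i)‖ → 0`. -/
def CuntzSubequiv {D : Type u} [NonUnitalCStarAlgebra D] (a b : D) : Prop :=
  ∃ x : ℕ → D, Tendsto (fun i => ‖a - star (x i) * b * x i‖) atTop (𝓝 0)

/-- The identification of `x ∈ M_n(A)` with `diag(x, 0) ∈ M_k(A)`, for `n ≤ k`. -/
def padMatrix {A : Type u} [Zero A] {n : ℕ} (k : ℕ) (x : CStarMatrix (Fin n) (Fin n) A) :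
    CStarMatrix (Fin k) (Fin k) A :=
  CStarMatrix.ofMatrix fun i j =>
    if h : (i : ℕ) < n ∧ (j : ℕ) < n then x ⟨i, h.1⟩ ⟨j, h.2⟩ else 0

/-- `a ⊕ b = diag(a, b)`. -/
def diagSum {A : Type u} [Zero A] {n m : ℕ} (a : CStarMatrix (Fin n) (Fin n) A)
    (b : CStarMatrix (Fin m) (Fin m) A) : CStarMatrix (Fin (n + m)) (Fin (n + m)) A :=
  CStarMatrix.ofMatrix
    ((Matrix.fromBlocks (CStarMatrix.ofMatrix.symm a) 0 0 (CStarMatrix.ofMatrix.symm b)).submatrix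
      finSumFinEquiv.symm finSumFinEquiv.symm)

/-- `M_∞(A)₊ = ⋃ₙ M_n(A)₊`: a positive matrix of some finite size. (The matrix of size `0` is
identified with `0`, so allowing it adds nothing.) -/
structure PosMatrix (A : Type u) [NonUnitalCStarAlgebra A] [PartialOrder A]
    [StarOrderedRing A] where
  size : ℕ
  mat : CStarMatrix (Fin size) (Fin size) A
  nonneg : 0 ≤ mat

theorem padMatrix_apply {A : Type u} [Zero A] {n : ℕ} (k : ℕ) (x : CStarMatrix (Fin n) (Fin n) A)
    (i j : Fin k) : padMatrix k x i j =
      if h : (i : ℕ) < n ∧ (j : ℕ) < n then x ⟨i, h.1⟩ ⟨j, h.2⟩ else 0 := rfl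

theorem diagSum_apply {A : Type u} [Zero A] {n m : ℕ} (a : CStarMatrix (Fin n) (Fin n) A)
    (b : CStarMatrix (Fin m) (Fin m) A) (s t : Fin n ⊕ Fin m) :
    diagSum a b (finSumFinEquiv s) (finSumFinEquiv t) =
      Matrix.fromBlocks (CStarMatrix.ofMatrix.symm a) 0 0 (CStarMatrix.ofMatrix.symm b) s t := by
  change Matrix.fromBlocks _ _ _ _ (finSumFinEquiv.symm (finSumFinEquiv s))
    (finSumFinEquiv.symm (finSumFinEquiv t)) = _
  rw [Equiv.symm_apply_apply, Equiv.symm_apply_apply]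

/-! Auxiliary facts on the rectangular form of Cuntz subequivalence. -/

/-- Cuntz subequivalence of square matrices of possibly different sizes, through rectangular
matrices. Only used to establish the properties of the Cuntz semigroup. -/
def RectSubequiv {A : Type u} [NonUnitalCStarAlgebra A] {m n : Type*} [Fintype m] [Fintype n]
    (a : Matrix m m A) (b : Matrix n n A) : Prop :=
  a ∈ closure (Set.range fun x : Matrix n m A => xᴴ * b * x)

namespace RectSubequiv

variable {A : Type u} [NonUnitalCStarAlgebra A]
variable {l m n k : Type*} [Fintype l] [Fintype m] [Fintype n] [Fintype k]

theorem trans {a : Matrix l l A} {b : Matrix m m A} {c : Matrix n n A}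
    (h₁ : RectSubequiv a b) (h₂ : RectSubequiv b c) : RectSubequiv a c := by
  have key : ∀ x : Matrix m l A, RectSubequiv (xᴴ * b * x) c := by
    intro x
    have hc : Continuous fun y : Matrix m m A => xᴴ * y * x := by fun_prop
    refine map_mem_closure (f := fun y : Matrix m m A => xᴴ * y * x) hc h₂ ?_
    rintro _ ⟨y, rfl⟩
    exact ⟨y * x, by simp [Matrix.conjTranspose_mul, Matrix.mul_assoc]⟩
  refine closure_minimal ?_ isClosed_closure h₁
  rintro _ ⟨x, rfl⟩
  exact key x

theorem submatrix_left {a : Matrix m m A} {b : Matrix n n A} (h : RectSubequiv a b) (f : l → m) :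
    RectSubequiv (a.submatrix f f) b := by
  have hc : Continuous fun y : Matrix m m A => y.submatrix f f := by fun_prop
  refine map_mem_closure (f := fun y : Matrix m m A => y.submatrix f f) hc h ?_
  rintro _ ⟨x, rfl⟩
  exact ⟨x.submatrix id f, by ext i j; simp [Matrix.mul_apply]⟩

theorem reindex_right {a : Matrix m m A} {b : Matrix n n A} (h : RectSubequiv a b) (e : k ≃ n) :
    RectSubequiv a (b.submatrix e e) := by
  refine closure_mono ?_ h
  rintro _ ⟨x, rfl⟩
  refine ⟨x.submatrix e id, ?_⟩
  ext i j
  simp only [Matrix.mul_apply, Matrix.conjTranspose_apply, Matrix.submatrix_apply, id]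
  rw [← e.sum_comp]
  refine Finset.sum_congr rfl fun s _ => ?_
  rw [← e.sum_comp]

theorem fromBlocks {a : Matrix l l A} {b : Matrix m m A} {a' : Matrix n n A} {b' : Matrix k k A}
    (h : RectSubequiv a b) (h' : RectSubequiv a' b') :
    RectSubequiv (Matrix.fromBlocks a 0 0 a') (Matrix.fromBlocks b 0 0 b') := by
  have hc : Continuous fun p : Matrix l l A × Matrix n n A => Matrix.fromBlocks p.1 0 0 p.2 := by
    fun_prop
  have hp : (a, a') ∈ closure ((Set.range fun x : Matrix m l A => xᴴ * b * x) ×ˢ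
      (Set.range fun x : Matrix k n A => xᴴ * b' * x)) := by
    rw [closure_prod_eq]
    exact ⟨h, h'⟩
  refine map_mem_closure
    (f := fun p : Matrix l l A × Matrix n n A => Matrix.fromBlocks p.1 0 0 p.2) hc hp ?_
  rintro ⟨_, _⟩ ⟨⟨x, rfl⟩, ⟨y, rfl⟩⟩
  refine ⟨Matrix.fromBlocks x 0 0 y, ?_⟩
  simp [Matrix.fromBlocks_conjTranspose, Matrix.fromBlocks_multiply]

theorem mul_padMatrix {r : Type*} {p q : ℕ} (hpq : p ≤ q) (b : CStarMatrix (Fin p) (Fin p) A)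
    (x : Matrix (Fin q) r A) :
    xᴴ * CStarMatrix.ofMatrix.symm (padMatrix q b) * x =
      (x.submatrix (Fin.castLE hpq) id)ᴴ * CStarMatrix.ofMatrix.symm b *
        x.submatrix (Fin.castLE hpq) id := by
  have hrange : ∀ i : Fin q, i ∉ Set.range (Fin.castLE hpq) → ¬ (i : ℕ) < p := by
    intro i hi h
    exact hi ⟨⟨i, h⟩, rfl⟩
  ext i j
  simp only [Matrix.mul_apply, Matrix.conjTranspose_apply, Matrix.submatrix_apply, id]
  symm
  refine Fintype.sum_of_injective (Fin.castLE hpq) (Fin.castLE_injective hpq) _ _ ?_ ?_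
  · intro s hs
    have := hrange s hs
    simp [padMatrix_apply, this]
  · intro s
    congr 1
    refine Fintype.sum_of_injective (Fin.castLE hpq) (Fin.castLE_injective hpq) _ _ ?_ ?_
    · intro t ht
      have := hrange t ht
      simp [padMatrix_apply, this]
    · intro t
      simp [padMatrix_apply]

theorem pad_right_iff {p q : ℕ} (hpq : p ≤ q) (a : Matrix m m A)
    (b : CStarMatrix (Fin p) (Fin p) A) :
    RectSubequiv a (CStarMatrix.ofMatrix.symm (padMatrix q b)) ↔
      RectSubequiv a (CStarMatrix.ofMatrix.symm b) := by
  unfold RectSubequiv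
  have : (Set.range fun x : Matrix (Fin q) m A =>
      xᴴ * CStarMatrix.ofMatrix.symm (padMatrix q b) * x) =
      Set.range fun x : Matrix (Fin p) m A => xᴴ * CStarMatrix.ofMatrix.symm b * x := by
    ext y
    constructor
    · rintro ⟨x, rfl⟩
      exact ⟨x.submatrix (Fin.castLE hpq) id, (mul_padMatrix hpq b x).symm⟩
    · rintro ⟨x, rfl⟩
      refine ⟨Matrix.of fun i j => if h : (i : ℕ) < p then x ⟨i, h⟩ j else 0, ?_⟩
      dsimp only
      rw [mul_padMatrix hpq]
      have : (Matrix.of fun (i : Fin q) j => if h : (i : ℕ) < p then x ⟨i, h⟩ j else 0).submatrix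
          (Fin.castLE hpq) id = x := by
        ext i j
        simp
      rw [this]
  rw [this]

theorem pad_left_iff {p q : ℕ} (hpq : p ≤ q) (a : CStarMatrix (Fin p) (Fin p) A)
    (b : Matrix n n A) :
    RectSubequiv (CStarMatrix.ofMatrix.symm (padMatrix q a)) b ↔
      RectSubequiv (CStarMatrix.ofMatrix.symm a) b := by
  constructor
  · intro h
    have := h.submatrix_left (Fin.castLE hpq)
    convert this using 1
    ext i j
    simp [padMatrix_apply]
  · intro h
    have hc : Continuous fun y : Matrix (Fin p) (Fin p) A =>
        CStarMatrix.ofMatrix.symm (padMatrix q (CStarMatrix.ofMatrix y)) := by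
      refine continuous_matrix fun i j => ?_
      by_cases hij : (i : ℕ) < p ∧ (j : ℕ) < p
      · simpa [padMatrix_apply, hij] using continuous_id.matrix_elem _ _
      · simpa [padMatrix_apply, hij] using continuous_const
    refine map_mem_closure (f := fun y : Matrix (Fin p) (Fin p) A =>
        CStarMatrix.ofMatrix.symm (padMatrix q (CStarMatrix.ofMatrix y))) hc h ?_
    rintro _ ⟨x, rfl⟩
    refine ⟨Matrix.of fun i j => if h : (j : ℕ) < p then x i ⟨j, h⟩ else 0, ?_⟩
    ext i j
    by_cases hi : (i : ℕ) < p <;> by_cases hj : (j : ℕ) < p <;>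
      simp [padMatrix_apply, hi, hj, Matrix.mul_apply]

end RectSubequiv

variable {A : Type u} [NonUnitalCStarAlgebra A] [PartialOrder A] [StarOrderedRing A]

theorem cuntzSubequiv_iff_mem_closure {D : Type u} [NonUnitalCStarAlgebra D] (a b : D) :
    CuntzSubequiv a b ↔ a ∈ closure (Set.range fun x : D => star x * b * x) := by
  rw [mem_closure_iff_seq_limit]
  constructor
  · rintro ⟨x, hx⟩
    refine ⟨fun i => star (x i) * b * x i, fun i => ⟨x i, rfl⟩, ?_⟩
    rw [tendsto_iff_norm_sub_tendsto_zero]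
    simpa only [norm_sub_rev] using hx
  · rintro ⟨y, hy, hlim⟩
    choose x hx using hy
    refine ⟨x, ?_⟩
    rw [tendsto_iff_norm_sub_tendsto_zero] at hlim
    simp only at hx
    simpa only [hx, norm_sub_rev] using hlim

theorem cuntzSubequiv_matrix_iff {n : ℕ} (a b : CStarMatrix (Fin n) (Fin n) A) :
    CuntzSubequiv a b ↔
      RectSubequiv (CStarMatrix.ofMatrix.symm a) (CStarMatrix.ofMatrix.symm b) :=
  cuntzSubequiv_iff_mem_closure a b

theorem CuntzSubequiv.refl {D : Type u} [NonUnitalCStarAlgebra D] [PartialOrder D]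
    [StarOrderedRing D] (a : D) : CuntzSubequiv a a := by
  rw [cuntzSubequiv_iff_mem_closure]
  have hl := CStarAlgebra.increasingApproximateUnit D
  set L := CStarAlgebra.approximateUnit D
  have h₁ : Tendsto (fun e => e * a) L (𝓝 a) := hl.tendsto_mul_right a
  have h₂ : Tendsto (fun e => a * e) L (𝓝 a) := hl.tendsto_mul_left a
  have h₃ : Tendsto (fun e => e * (a * e - a)) L (𝓝 0) := by
    rw [tendsto_iff_norm_sub_tendsto_zero] at h₂
    refine squeeze_zero_norm' ?_ h₂
    filter_upwards [hl.eventually_norm] with e he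
    calc ‖e * (a * e - a)‖ ≤ ‖e‖ * ‖a * e - a‖ := norm_mul_le _ _
      _ ≤ 1 * ‖a * e - a‖ := by gcongr
      _ = ‖a * e - a‖ := one_mul _
  have h₄ : Tendsto (fun e => star e * a * e) L (𝓝 a) := by
    have := h₃.add h₁
    rw [zero_add] at this
    refine this.congr' ?_
    filter_upwards [hl.eventually_star_eq] with e he
    rw [he, mul_sub, sub_add_cancel, mul_assoc]
  exact mem_closure_of_tendsto h₄ (Eventually.of_forall fun e => ⟨e, rfl⟩)

theorem RectSubequiv.refl {n : ℕ} (a : CStarMatrix (Fin n) (Fin n) A) :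
    RectSubequiv (CStarMatrix.ofMatrix.symm a) (CStarMatrix.ofMatrix.symm a) :=
  (cuntzSubequiv_matrix_iff a a).1 (CuntzSubequiv.refl a)

theorem exists_eq_star_mul_self {D : Type u} [NonUnitalCStarAlgebra D] [PartialOrder D]
    [StarOrderedRing D] {a : D} (ha : 0 ≤ a) : ∃ x : D, a = star x * x :=
  CStarAlgebra.nonneg_iff_eq_star_mul_self.1 ha

theorem diagSum_nonneg {n m : ℕ} {a : CStarMatrix (Fin n) (Fin n) A}
    {b : CStarMatrix (Fin m) (Fin m) A} (ha : 0 ≤ a) (hb : 0 ≤ b) : 0 ≤ diagSum a b := by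
  obtain ⟨x, rfl⟩ := exists_eq_star_mul_self ha
  obtain ⟨y, rfl⟩ := exists_eq_star_mul_self hb
  have : diagSum (star x * x) (star y * y) = star (diagSum x y) * diagSum x y := by
    ext i j
    obtain ⟨i, rfl⟩ := finSumFinEquiv.surjective i
    obtain ⟨j, rfl⟩ := finSumFinEquiv.surjective j
    rw [CStarMatrix.mul_apply, ← finSumFinEquiv.sum_comp]
    simp only [CStarMatrix.star_apply, diagSum_apply]
    rcases i with i | i <;> rcases j with j | j <;>
      simp [CStarMatrix.star_apply, CStarMatrix.mul_apply]
  rw [this]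
  exact star_mul_self_nonneg _

/-! ### The Cuntz semigroup `W(A)` -/

/-- `a ≤ b` in `M_∞(A)₊` means `a ≲ b`, after identifying `a` and `b` with elements of a common
matrix algebra. -/
instance PosMatrix.instPreorder : Preorder (PosMatrix A) where
  le a b := CuntzSubequiv (padMatrix (max a.size b.size) a.mat)
    (padMatrix (max a.size b.size) b.mat)
  le_refl a := CuntzSubequiv.refl _
  le_trans a b c h₁ h₂ := by
    rw [cuntzSubequiv_matrix_iff, RectSubequiv.pad_left_iff (le_max_left _ _),
      RectSubequiv.pad_right_iff (le_max_right _ _)] at *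
    exact h₁.trans h₂

theorem PosMatrix.le_iff_rectSubequiv (a b : PosMatrix A) :
    a ≤ b ↔ RectSubequiv (CStarMatrix.ofMatrix.symm a.mat) (CStarMatrix.ofMatrix.symm b.mat) := by
  change CuntzSubequiv _ _ ↔ _
  rw [cuntzSubequiv_matrix_iff, RectSubequiv.pad_left_iff (le_max_left _ _),
    RectSubequiv.pad_right_iff (le_max_right _ _)]

/-- The direct sum on `M_∞(A)₊`. -/
instance PosMatrix.instAdd : Add (PosMatrix A) where
  add a b := ⟨a.size + b.size, diagSum a.mat b.mat, diagSum_nonneg a.nonneg b.nonneg⟩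

/-- The empty matrix, identified with `0`. -/
instance PosMatrix.instZero : Zero (PosMatrix A) where
  zero := ⟨0, 0, le_rfl⟩

theorem PosMatrix.add_le_add {a b c d : PosMatrix A} (h₁ : a ≤ b) (h₂ : c ≤ d) :
    a + c ≤ b + d := by
  rw [PosMatrix.le_iff_rectSubequiv] at *
  exact ((h₁.fromBlocks h₂).submatrix_left finSumFinEquiv.symm).reindex_right finSumFinEquiv.symm

theorem PosMatrix.le_of_reindex {a b : PosMatrix A} (e : Fin b.size ≃ Fin a.size)
    (h : ∀ i j, b.mat i j = a.mat (e i) (e j)) : a ≤ b := by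
  rw [PosMatrix.le_iff_rectSubequiv]
  have := (RectSubequiv.refl a.mat).reindex_right e
  convert this using 1
  ext i j
  exact h i j

theorem PosMatrix.equiv_of_reindex {a b : PosMatrix A} (e : Fin b.size ≃ Fin a.size)
    (h : ∀ i j, b.mat i j = a.mat (e i) (e j)) : AntisymmRel (· ≤ ·) a b :=
  ⟨le_of_reindex e h, le_of_reindex e.symm fun i j => by simp [h]⟩

theorem PosMatrix.add_mat_apply (a b : PosMatrix A) (s t : Fin a.size ⊕ Fin b.size) :
    (a + b).mat (finSumFinEquiv s) (finSumFinEquiv t) =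
      Matrix.fromBlocks (CStarMatrix.ofMatrix.symm a.mat) 0 0
        (CStarMatrix.ofMatrix.symm b.mat) s t :=
  diagSum_apply _ _ _ _

theorem PosMatrix.add_comm_equiv (a b : PosMatrix A) :
    AntisymmRel (· ≤ ·) (a + b) (b + a) := by
  refine equiv_of_reindex
    ((finSumFinEquiv.symm.trans (Equiv.sumComm (Fin b.size) (Fin a.size))).trans finSumFinEquiv)
    fun i j => ?_
  obtain ⟨i, rfl⟩ := (finSumFinEquiv (m := b.size) (n := a.size)).surjective i
  obtain ⟨j, rfl⟩ := (finSumFinEquiv (m := b.size) (n := a.size)).surjective j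
  simp only [Equiv.trans_apply, Equiv.symm_apply_apply]
  erw [add_mat_apply, add_mat_apply]
  rcases i with i | i <;> rcases j with j | j <;> simp

theorem PosMatrix.add_assoc_equiv (a b c : PosMatrix A) :
    AntisymmRel (· ≤ ·) (a + b + c) (a + (b + c)) := by
  let e₁ : (Fin a.size ⊕ Fin b.size) ⊕ Fin c.size ≃ Fin (a + b + c).size :=
    (Equiv.sumCongr finSumFinEquiv (Equiv.refl _)).trans finSumFinEquiv
  let e₂ : Fin a.size ⊕ (Fin b.size ⊕ Fin c.size) ≃ Fin (a + (b + c)).size :=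
    (Equiv.sumCongr (Equiv.refl _) finSumFinEquiv).trans finSumFinEquiv
  refine equiv_of_reindex ((e₂.symm.trans (Equiv.sumAssoc _ _ _).symm).trans e₁) fun i j => ?_
  obtain ⟨i, rfl⟩ := e₂.surjective i
  obtain ⟨j, rfl⟩ := e₂.surjective j
  simp only [Equiv.trans_apply, Equiv.symm_apply_apply]
  change (a + (b + c)).mat (finSumFinEquiv _) (finSumFinEquiv _) =
    (a + b + c).mat (finSumFinEquiv _) (finSumFinEquiv _)
  erw [add_mat_apply, add_mat_apply]
  rcases i with i | i | i <;> rcases j with j | j | j <;> simp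
  · exact (add_mat_apply a b (.inl i) (.inl j)).symm
  · exact (add_mat_apply a b (.inl i) (.inr j)).symm
  · exact (add_mat_apply a b (.inr i) (.inl j)).symm
  · exact (add_mat_apply b c (.inl i) (.inl j)).trans (add_mat_apply a b (.inr i) (.inr j)).symm
  · exact add_mat_apply b c (.inl i) (.inr j)
  · exact add_mat_apply b c (.inr i) (.inl j)
  · exact add_mat_apply b c (.inr i) (.inr j)

theorem PosMatrix.zero_add_equiv (a : PosMatrix A) : AntisymmRel (· ≤ ·) (0 + a) a := by
  refine equiv_of_reindex ((Equiv.emptySum (Fin 0) (Fin a.size)).symm.trans finSumFinEquiv)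
    fun i j => ?_
  simp only [Equiv.trans_apply]
  erw [add_mat_apply]
  rfl

/-- The Cuntz semigroup `W(A) = M_∞(A)₊ / ∼`, where `a ∼ b` means `a ≲ b` and `b ≲ a`. -/
def CuntzSemigroup (A : Type u) [NonUnitalCStarAlgebra A] [PartialOrder A]
    [StarOrderedRing A] : Type u :=
  Antisymmetrization (PosMatrix A) (· ≤ ·)

namespace CuntzSemigroup

/-- The class `⟨a⟩` of `a ∈ M_∞(A)₊`. -/
def mk (a : PosMatrix A) : CuntzSemigroup A := toAntisymmetrization (· ≤ ·) a

/-- The order of `W(A)`: `⟨a⟩ ≤ ⟨b⟩` if and only if `a ≲ b`. -/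
instance instPartialOrder : PartialOrder (CuntzSemigroup A) :=
  inferInstanceAs (PartialOrder (Antisymmetrization (PosMatrix A) (· ≤ ·)))

theorem mk_le_mk {a b : PosMatrix A} : mk a ≤ mk b ↔ a ≤ b := Iff.rfl

theorem mk_eq_mk {a b : PosMatrix A} : mk a = mk b ↔ AntisymmRel (· ≤ ·) a b := Quotient.eq

/-- The addition of `W(A)`: `⟨a⟩ + ⟨b⟩ = ⟨a ⊕ b⟩`. -/
instance instAdd : Add (CuntzSemigroup A) where
  add := Quotient.map₂ (· + ·) fun _ _ h₁ _ _ h₂ =>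
    ⟨PosMatrix.add_le_add h₁.1 h₂.1, PosMatrix.add_le_add h₁.2 h₂.2⟩

instance instZero : Zero (CuntzSemigroup A) where
  zero := mk 0

theorem mk_add_mk (a b : PosMatrix A) : mk a + mk b = mk (a + b) := rfl

theorem mk_surjective : Function.Surjective (mk : PosMatrix A → CuntzSemigroup A) :=
  Quotient.mk_surjective

instance instAddCommMonoid : AddCommMonoid (CuntzSemigroup A) where
  add_assoc x y z := by
    obtain ⟨a, rfl⟩ := mk_surjective x
    obtain ⟨b, rfl⟩ := mk_surjective y
    obtain ⟨c, rfl⟩ := mk_surjective z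
    exact mk_eq_mk.2 (PosMatrix.add_assoc_equiv a b c)
  add_comm x y := by
    obtain ⟨a, rfl⟩ := mk_surjective x
    obtain ⟨b, rfl⟩ := mk_surjective y
    exact mk_eq_mk.2 (PosMatrix.add_comm_equiv a b)
  zero_add x := by
    obtain ⟨a, rfl⟩ := mk_surjective x
    exact mk_eq_mk.2 (PosMatrix.zero_add_equiv a)
  add_zero x := by
    obtain ⟨a, rfl⟩ := mk_surjective x
    exact (mk_eq_mk.2 (PosMatrix.add_comm_equiv a 0)).trans
      (mk_eq_mk.2 (PosMatrix.zero_add_equiv a))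
  nsmul := nsmulRec

end CuntzSemigroup

end Cuntz

/-! ### Almost unperforation and asymptotical tracial approximation -/

/-- `W(A)` is almost unperforated: `(k + 1)⟨a⟩ ≤ k⟨b⟩` with `k ≥ 1` implies `⟨a⟩ ≤ ⟨b⟩`. -/
def AlmostUnperforatedCuntzSemigroup (A : Type u) [NonUnitalCStarAlgebra A] [PartialOrder A]
    [StarOrderedRing A] : Prop :=
  ∀ (x y : CuntzSemigroup A) (k : ℕ), 1 ≤ k → (k + 1) • x ≤ k • y → x ≤ y

/-- A class of C⋆-algebras (each with its usual order, in which the positive elements are those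
of the form `x⋆ x`). -/
abbrev CStarClass : Type (v + 1) :=
  ∀ (B : Type v) [NonUnitalCStarAlgebra B] [PartialOrder B] [StarOrderedRing B], Prop

/-- The class `𝒲` of unital C⋆-algebras whose Cuntz semigroup is almost unperforated. -/
def ClassW : CStarClass.{v} := fun B _ _ _ =>
  (∃ e : B, ∀ x : B, e * x = x ∧ x * e = x) ∧ AlmostUnperforatedCuntzSemigroup B

/-- A C⋆-algebra is simple if it is nonzero and has no closed two-sided ideals other than `0` and
itself. -/
def IsSimpleCStarAlgebra (A : Type u) [NonUnitalCStarAlgebra A] : Prop :=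
  Nontrivial A ∧ ∀ I : TwoSidedIdeal A, IsClosed (I : Set A) → I = ⊥ ∨ I = ⊤

/-- `φ` is contractive; a c.p.c. map is a contractive completely positive linear map. -/
def CompletelyPositiveMap.IsContractive {A : Type u} {B : Type v} [NonUnitalCStarAlgebra A]
    [PartialOrder A] [StarOrderedRing A] [NonUnitalCStarAlgebra B] [PartialOrder B]
    [StarOrderedRing B] (φ : A →CP B) : Prop :=
  ∀ x : A, ‖φ x‖ ≤ ‖x‖

/-- `φ` is an `(F, ε)`-approximate embedding. -/
def IsApproxEmbedding {A : Type u} {B : Type v} [NonUnitalCStarAlgebra A]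
    [NonUnitalCStarAlgebra B] (F : Set A) (ε : ℝ) (φ : A → B) : Prop :=
  (∀ x ∈ F, ∀ y ∈ F, ‖φ (x * y) - φ x * φ y‖ < ε) ∧ ∀ x ∈ F, |‖φ x‖ - ‖x‖| < ε

/-- The unital C⋆-algebra `A` (normally assumed simple) is asymptotically tracially in the
class `P`. -/
def AsymptoticallyTraciallyIn (A : Type u) [CStarAlgebra A] [PartialOrder A] [StarOrderedRing A]
    (P : CStarClass.{v}) : Prop :=
  ∀ (F : Finset A) (ε : ℝ), 0 < ε → ∀ a : A, 0 ≤ a → a ≠ 0 →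
    ∃ (B : Type v) (_ : NonUnitalCStarAlgebra B) (_ : PartialOrder B) (_ : StarOrderedRing B)
      (α : A →CP B) (β : ℕ → (B →CP A)) (γ : ℕ → (A →CP A)),
      P B ∧ α.IsContractive ∧ (∀ n, (β n).IsContractive) ∧ (∀ n, (γ n).IsContractive) ∧
      (∀ x ∈ F, ∀ n, ‖x - (γ n x + β n (α x))‖ < ε) ∧
      IsApproxEmbedding (F : Set A) ε α ∧
      (∀ x y : B, Tendsto (fun n => ‖β n (x * y) - β n x * β n y‖) atTop (𝓝 0)) ∧
      (∀ x : B, Tendsto (fun n => ‖β n x‖) atTop (𝓝 ‖x‖)) ∧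
      ∀ n, CuntzSubequiv (γ n 1) a

/-! Suppose `(k+1)⟨a⟩ ≤ k⟨b⟩`, with `a` of size `p` and `b` of size `q`. Apply the almost
multiplicative map `α` to this relation, cancel the multiplicity in `B`, where that is allowed, and
return to `A` by some `β_n`. Since `a ≈ γ_n(a) + β_n(α(a))` and `γ_n(a) ≤ ‖a‖ γ_n(1) ⊗ 1_p`, this
yields `⟨a⟩ ≤ p⟨d⟩ + ⟨b⟩` for every nonzero positive `d` in `A` (`CuntzLE.scalarDiag_dirSum`). On
the side of `b` the summand `γ_n(b)` is positive and can be discarded.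

It remains to absorb `p⟨d⟩`. If `M_q(A)` has no minimal projection and `b ≠ 0`, room can be made
inside `b`: `exists_room` gives `b₁` and `c ≠ 0` with `⟨b₁⟩ + ⟨c⟩ ≤ ⟨b⟩` and `2k⟨b⟩ ≤ (2k+1)⟨b₁⟩`.
Then `(2k+2)⟨a⟩ ≤ (2k+1)⟨b₁⟩`, which is a relation of the original kind. The first step applies to
`a` and `b₁`, and `exists_scalarDiag_le` supplies a `d` with `p⟨d⟩ ≤ ⟨c⟩`. If there is a minimal
projection, then `A` has one too, every positive matrix over `A` is Cuntz equivalent to a diagonal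
sum of copies of it, and comparison reduces to comparison of ranks
(`IsMinimalProjection.almostUnperforated`).

The estimates are carried as order inequalities `a ≤ x⋆ b x + ε`. These survive compressions and
completely positive maps, and `CuntzLE.of_forall_le_add` turns them back into subequivalences. For
the return to `A`, `t - η` replaces `(t - η)₊`: it is linear in `t`, so almost multiplicative maps
respect its compressions. -/

/-! ### Cut-downs and basic Cuntz comparison by functional calculus. -/

section FunctionalCalculus

variable {D : Type u} [CStarAlgebra D] [PartialOrder D] [StarOrderedRing D]

/-- The real number `r`, as an element of a unital C⋆-algebra. -/
noncomputable def realScalar (D : Type*) [CStarAlgebra D] (r : ℝ) : D := algebraMap ℝ D r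

/-- The cut-down `(a - η)₊`. -/
noncomputable def cutDown (a : D) (η : ℝ) : D := cfc (fun t : ℝ => max (t - η) 0) a

theorem cutDown_nonneg (a : D) (η : ℝ) : 0 ≤ cutDown a η :=
  cfc_nonneg fun _ _ => le_max_right _ _

omit [PartialOrder D] [StarOrderedRing D] in
theorem cfc_sub_realScalar {a : D} (ha : IsSelfAdjoint a) (η : ℝ) :
    cfc (fun t : ℝ => t - η) a = a - realScalar D η := by
  rw [cfc_sub (fun t : ℝ => t) (fun _ => η) a, cfc_id' ℝ a, cfc_const η a, realScalar]

theorem le_cutDown_add {a : D} (ha : IsSelfAdjoint a) (η : ℝ) :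
    a - realScalar D η ≤ cutDown a η := by
  rw [← cfc_sub_realScalar ha]
  exact cfc_mono fun _ _ => le_max_left _ _

theorem norm_sub_cutDown_le {a : D} (ha : 0 ≤ a) {η : ℝ} (hη : 0 ≤ η) :
    ‖a - cutDown a η‖ ≤ η := by
  have hs : IsSelfAdjoint a := .of_nonneg ha
  have : a - cutDown a η = cfc (fun t : ℝ => t - max (t - η) 0) a := by
    rw [cfc_sub (fun t : ℝ => t) (fun t => max (t - η) 0) a, cfc_id' ℝ a, cutDown]
  rw [this]
  refine norm_cfc_le hη fun t ht => ?_
  have := spectrum_nonneg_of_nonneg ha ht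
  rw [Real.norm_eq_abs, abs_le]
  constructor <;> cases max_cases (t - η) 0 <;> linarith

omit [PartialOrder D] [StarOrderedRing D] in
-- The cut-down vanishes where `t ≤ η`, so between two copies of it `t - η` and its positive part
-- agree. The cube of a cut-down is thereby a compression of `a - η` itself.
theorem cutDown_mul_sub_mul_cutDown {a : D} (ha : IsSelfAdjoint a) (η : ℝ) :
    cutDown a η * (a - realScalar D η) * cutDown a η =
      cutDown a η * cutDown a η * cutDown a η := by
  rw [← cfc_sub_realScalar ha, cutDown, ← cfc_mul .., ← cfc_mul .., ← cfc_mul .., ← cfc_mul ..]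
  refine cfc_congr fun t _ => ?_
  rcases max_cases (t - η) 0 with h | h <;> rw [h.1] <;> ring

theorem realScalar_mono : Monotone (realScalar D) := algebraMap_mono D

omit [PartialOrder D] [StarOrderedRing D] in
theorem realScalar_add (r s : ℝ) : realScalar D (r + s) = realScalar D r + realScalar D s :=
  map_add _ _ _

omit [PartialOrder D] [StarOrderedRing D] in
theorem realScalar_eq_smul (r : ℝ) : realScalar D r = (r : ℂ) • 1 := by
  rw [realScalar, Algebra.algebraMap_eq_smul_one, Complex.coe_smul]

theorem le_realScalar_of_norm_le {x : D} (hx : IsSelfAdjoint x) {r : ℝ} (h : ‖x‖ ≤ r) :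
    x ≤ realScalar D r :=
  (hx.le_algebraMap_norm_self).trans (algebraMap_mono D h)

theorem le_add_realScalar_of_norm_sub_le {x y : D} {r : ℝ} (hxy : IsSelfAdjoint (x - y))
    (h : ‖x - y‖ ≤ r) : x ≤ y + realScalar D r := by
  rw [← sub_le_iff_le_add']
  exact le_realScalar_of_norm_le hxy h

theorem max_inv_continuous {δ : ℝ} (hδ : 0 < δ) : Continuous fun t : ℝ => (max t δ)⁻¹ :=
  Continuous.inv₀ (by fun_prop) fun t => (hδ.trans_le (le_max_right _ _)).ne'

omit [PartialOrder D] [StarOrderedRing D] in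
theorem cuntzSubequiv_of_forall {a b : D} (h : ∀ ε > 0, ∃ x : D, ‖a - star x * b * x‖ ≤ ε) :
    CuntzSubequiv a b := by
  rw [cuntzSubequiv_iff_mem_closure, Metric.mem_closure_iff]
  intro ε hε
  obtain ⟨x, hx⟩ := h (ε / 2) (by positivity)
  exact ⟨_, ⟨x, rfl⟩, by rw [dist_eq_norm]; linarith⟩

omit [PartialOrder D] [StarOrderedRing D] in
theorem cfc_mul_self_mul_cfc {b : D} (hb : IsSelfAdjoint b) {f : ℝ → ℝ} (hf : Continuous f) :
    cfc f b * b * cfc f b = cfc (fun t => f t * t * f t) b := by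
  have hf' := hf.continuousOn (s := spectrum ℝ b)
  rw [cfc_mul (fun t => f t * t) f b, cfc_mul f (fun t => t) b, cfc_id' ℝ b]

/-- Multiplying `t³` by `1 / max t δ` on both sides returns `t` exactly where `t ≥ δ`; below `δ` the
error is at most `t`. -/
theorem CuntzSubequiv.cube {a : D} (ha : 0 ≤ a) : CuntzSubequiv a (a * a * a) := by
  have hs : IsSelfAdjoint a := .of_nonneg ha
  refine cuntzSubequiv_of_forall fun δ hδ => ⟨cfc (fun t : ℝ => (max t δ)⁻¹) a, ?_⟩
  have hc := max_inv_continuous hδ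
  have hc' := hc.continuousOn (s := spectrum ℝ a)
  have h1 : IsSelfAdjoint (cfc (fun t : ℝ => (max t δ)⁻¹) a) := cfc_predicate _ a
  have h2 : a - star (cfc (fun t : ℝ => (max t δ)⁻¹) a) * (a * a * a) *
      cfc (fun t : ℝ => (max t δ)⁻¹) a =
      cfc (fun t : ℝ => t - (max t δ)⁻¹ * (t * t * t) * (max t δ)⁻¹) a := by
    rw [h1.star_eq, cfc_sub (fun t : ℝ => t) _ a, cfc_mul _ (fun t : ℝ => (max t δ)⁻¹) a,
      cfc_mul (fun t : ℝ => (max t δ)⁻¹) (fun t => t * t * t) a,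
      cfc_mul (fun t : ℝ => t * t) (fun t => t) a, cfc_mul (fun t : ℝ => t) (fun t => t) a,
      cfc_id' ℝ a]
  rw [h2]
  refine norm_cfc_le hδ.le fun t ht => ?_
  have ht0 := spectrum_nonneg_of_nonneg ha ht
  rw [Real.norm_eq_abs, abs_le]
  rcases le_total t δ with h | h
  · rw [max_eq_right h]
    have e : δ⁻¹ * (t * t * t) * δ⁻¹ = t * (t / δ) ^ 2 := by field_simp
    have h3 : t / δ ≤ 1 := (div_le_one hδ).2 h
    have h4 : 0 ≤ t / δ := by positivity
    have h5 : (t / δ) ^ 2 ≤ 1 := by nlinarith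
    rw [e]
    constructor <;> nlinarith [mul_nonneg ht0 (sq_nonneg (t / δ)), mul_nonneg ht0 (sub_nonneg.2 h5)]
  · have : 0 < t := hδ.trans_le h
    rw [max_eq_left h]
    have e : t⁻¹ * (t * t * t) * t⁻¹ = t := by field_simp
    rw [e]
    constructor <;> linarith

/-- Let `s = √a`, let `g` be the inverse square root of `max b δ`, and `k = 1 - g b g`. The error of
the compression by `g s` is `s k s`, and `‖k s‖² = ‖k a k‖ ≤ ‖k b k‖ ≤ δ`. -/
theorem CuntzSubequiv.of_le {a b : D} (ha : 0 ≤ a) (hab : a ≤ b) : CuntzSubequiv a b := by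
  have hb := ha.trans hab
  have hs : IsSelfAdjoint b := .of_nonneg hb
  set s := CFC.sqrt a with hsd
  have hss : IsSelfAdjoint s := .of_nonneg (CFC.sqrt_nonneg a)
  have hsa : s * s = a := CFC.sqrt_mul_sqrt_self a
  have key : ∀ ε > 0, ∃ x : D, ‖a - star x * b * x‖ ≤ ‖s‖ * ε := by
    intro ε hε
    -- The C⋆-identity bounds the square of `‖k s‖` by `δ`.
    set δ : ℝ := ε ^ 2 with hδd
    have hδ : 0 < δ := by positivity
    have hc := max_inv_continuous hδ
    have hcs : Continuous fun t : ℝ => √((max t δ)⁻¹) := Real.continuous_sqrt.comp hc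
    have hc' := hc.continuousOn (s := spectrum ℝ b)
    have hcs' := hcs.continuousOn (s := spectrum ℝ b)
    set g := cfc (fun t : ℝ => √((max t δ)⁻¹)) b with hg
    have hgs : IsSelfAdjoint g := cfc_predicate _ b
    set k := cfc (fun t : ℝ => 1 - t * (max t δ)⁻¹) b with hk
    have hks : IsSelfAdjoint k := cfc_predicate _ b
    have hgbg : 1 - g * b * g = k := by
      have : cfc (fun t : ℝ => √((max t δ)⁻¹) * t * √((max t δ)⁻¹)) b =
          cfc (fun t : ℝ => t * (max t δ)⁻¹) b := by
        refine cfc_congr fun t _ => ?_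
        have : 0 ≤ (max t δ)⁻¹ := inv_nonneg.2 (hδ.le.trans (le_max_right _ _))
        rw [mul_right_comm, Real.mul_self_sqrt this, mul_comm]
      rw [hg, cfc_mul_self_mul_cfc hs hcs, this, hk,
        cfc_sub (fun _ : ℝ => 1) (fun t : ℝ => t * (max t δ)⁻¹) b continuousOn_const
          (continuous_id.mul hc).continuousOn, cfc_const_one ℝ b]
    have hkbk : ‖k * b * k‖ ≤ δ := by
      rw [hk, cfc_mul_self_mul_cfc (f := fun t : ℝ => 1 - t * (max t δ)⁻¹) hs
        (continuous_const.sub (continuous_id.mul hc))]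
      refine norm_cfc_le hδ.le fun t ht => ?_
      have ht0 := spectrum_nonneg_of_nonneg hb ht
      rw [Real.norm_eq_abs, abs_le]
      rcases le_total t δ with h | h
      · rw [max_eq_right h]
        have h3 : t * δ⁻¹ ≤ 1 := by rw [← div_eq_mul_inv]; exact (div_le_one hδ).2 h
        have h4 : 0 ≤ t * δ⁻¹ := by positivity
        have h5 : (1 - t * δ⁻¹) ^ 2 ≤ 1 := by nlinarith
        have h6 := mul_nonneg ht0 (sq_nonneg (1 - t * δ⁻¹))
        have h7 := mul_nonneg ht0 (sub_nonneg.2 h5)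
        have h8 : (1 - t * δ⁻¹) * t * (1 - t * δ⁻¹) = t * (1 - t * δ⁻¹) ^ 2 := by ring
        rw [h8]
        constructor <;> linarith
      · have : 0 < t := hδ.trans_le h
        rw [max_eq_left h, mul_inv_cancel₀ this.ne']
        simp [hδ.le]
    have hks2 : ‖k * s‖ ≤ ε := by
      have h1 : ‖k * s‖ * ‖k * s‖ = ‖k * a * k‖ := by
        rw [← CStarRing.norm_self_mul_star, star_mul, hks.star_eq, hss.star_eq, mul_assoc,
          ← mul_assoc s, hsa, mul_assoc]
      have h2 : ‖k * a * k‖ ≤ ‖k * b * k‖ :=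
        CStarAlgebra.norm_le_norm_of_nonneg_of_le (hks.conjugate_nonneg ha)
          (hks.conjugate_le_conjugate hab)
      nlinarith [norm_nonneg (k * s)]
    refine ⟨g * s, ?_⟩
    have : a - star (g * s) * b * (g * s) = s * (k * s) := by
      rw [star_mul, hgs.star_eq, hss.star_eq, ← hgbg, ← hsa]
      noncomm_ring
    rw [this]
    exact (norm_mul_le _ _).trans (by gcongr)
  refine cuntzSubequiv_of_forall fun ε hε => ?_
  obtain ⟨x, hx⟩ := key (ε / (‖s‖ + 1)) (by positivity)
  refine ⟨x, hx.trans ?_⟩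
  rw [mul_div_assoc', div_le_iff₀ (by positivity)]
  nlinarith [norm_nonneg s]

end FunctionalCalculus

/-! ### Rectangular compressions, amplifications and Cuntz comparison of matrices. -/

section MatrixAlgebra

set_option linter.unusedSectionVars false

variable {A : Type u} [CStarAlgebra A]
variable {l m n κ : Type*} [Fintype l] [Fintype m] [Fintype n] [Fintype κ]

namespace CStarMatrix

/-- The compression `xᴴ b x` of a square matrix by a rectangular one. -/
def conj (x : Matrix n m A) (b : CStarMatrix n n A) : CStarMatrix m m A :=
  ofMatrix (xᴴ * ofMatrix.symm b * x)

/-- The positive matrix `xᴴ x`. -/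
def gram (x : Matrix n m A) : CStarMatrix m m A := ofMatrix (xᴴ * x)

theorem conj_conj (y : Matrix m l A) (x : Matrix n m A) (b : CStarMatrix n n A) :
    conj y (conj x b) = conj (x * y) b := by
  change yᴴ * (xᴴ * ofMatrix.symm b * x) * y = (x * y)ᴴ * ofMatrix.symm b * (x * y)
  simp [Matrix.conjTranspose_mul, Matrix.mul_assoc]

theorem conj_sub (x : Matrix n m A) (a b : CStarMatrix n n A) :
    conj x (a - b) = conj x a - conj x b := by
  change xᴴ * (ofMatrix.symm a - ofMatrix.symm b) * x =
    xᴴ * ofMatrix.symm a * x - xᴴ * ofMatrix.symm b * x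
  rw [Matrix.mul_sub, Matrix.sub_mul]

theorem conj_smul (x : Matrix n m A) (r : ℝ) (a : CStarMatrix n n A) :
    conj x (r • a) = r • conj x a := by
  change xᴴ * (r • ofMatrix.symm a) * x = r • (xᴴ * ofMatrix.symm a * x)
  rw [Matrix.mul_smul, Matrix.smul_mul]

theorem conj_ofMatrix_symm (x b : CStarMatrix n n A) :
    conj (ofMatrix.symm x) b = star x * b * x := rfl

theorem conj_gram (y : Matrix m l A) (x : Matrix n m A) : conj y (gram x) = gram (x * y) := by
  change yᴴ * (xᴴ * x) * y = (x * y)ᴴ * (x * y)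
  simp [Matrix.conjTranspose_mul, Matrix.mul_assoc]

variable [PartialOrder A] [StarOrderedRing A]

theorem conj_one [DecidableEq n] (x : Matrix n m A) : conj x 1 = gram x := by
  change xᴴ * (1 : Matrix n n A) * x = xᴴ * x
  rw [Matrix.mul_one]

/-- A rectangular matrix is not an element of a C⋆-algebra, but each of its rows, placed in row `i₀`
of a square matrix, is. The Gram matrix is the sum of the resulting squares. -/
theorem gram_nonneg (x : Matrix n m A) : 0 ≤ gram x := by
  classical
  cases isEmpty_or_nonempty m with
  | inl h => exact (ext fun i => h.elim i : 0 = gram x).le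
  | inr h =>
    obtain ⟨i₀⟩ := h
    let S (k : n) : CStarMatrix m m A := ofMatrix (Matrix.of fun i j => if i = i₀ then x k j else 0)
    have : gram x = ∑ k, star (S k) * S k := by
      ext i j
      have h₁ : (∑ k, star (S k) * S k) i j = ∑ k, (star (S k) * S k) i j :=
        Matrix.sum_apply i j _ _
      rw [h₁]
      refine Finset.sum_congr rfl fun k _ => ?_
      rw [mul_apply]
      simp [S, star_apply, Matrix.conjTranspose_apply]
    rw [this]
    exact Finset.sum_nonneg fun k _ => star_mul_self_nonneg _

theorem conj_nonneg (x : Matrix n m A) {b : CStarMatrix n n A} (hb : 0 ≤ b) :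
    0 ≤ conj x b := by
  obtain ⟨y, rfl⟩ := exists_eq_star_mul_self hb
  change 0 ≤ conj x (gram (ofMatrix.symm y))
  rw [conj_gram]
  exact gram_nonneg _

theorem conj_mono (x : Matrix n m A) {a b : CStarMatrix n n A} (h : a ≤ b) :
    conj x a ≤ conj x b := by
  rw [← sub_nonneg, ← conj_sub]
  exact conj_nonneg x (sub_nonneg.2 h)

/-- On the diagonal the embedding is a ⋆-homomorphism, hence contractive. The C⋆-identity reduces
the off-diagonal case to it. -/
theorem norm_single_le [DecidableEq m] (i j : m) (a : A) :
    ‖(ofMatrix (Matrix.single i j a) : CStarMatrix m m A)‖ ≤ ‖a‖ := by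
  have hd : ∀ (i : m) (a : A),
      ‖(ofMatrix (Matrix.single i i a) : CStarMatrix m m A)‖ ≤ ‖a‖ := by
    intro i a
    let φ : A →⋆ₙₐ[ℂ] CStarMatrix m m A :=
      { toFun a := ofMatrix (Matrix.single i i a)
        map_smul' r a := (Matrix.smul_single r i i a).symm
        map_zero' := Matrix.single_zero i i
        map_add' a b := Matrix.single_add i i a b
        map_mul' a b := (Matrix.single_mul_single_same (c := a) i i i b).symm
        map_star' a := (Matrix.conjTranspose_single i i a).symm }
    exact NonUnitalStarAlgHom.norm_apply_le φ a
  have h : star (ofMatrix (Matrix.single i j a) : CStarMatrix m m A) *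
      ofMatrix (Matrix.single i j a) = ofMatrix (Matrix.single j j (star a * a)) := by
    change (Matrix.single i j a)ᴴ * Matrix.single i j a = Matrix.single j j (star a * a)
    rw [Matrix.conjTranspose_single, Matrix.single_mul_single_same]
  have h2 := hd j (star a * a)
  rw [← h, CStarRing.norm_star_mul_self, CStarRing.norm_star_mul_self] at h2
  nlinarith [norm_nonneg a, norm_nonneg (ofMatrix (Matrix.single i j a) : CStarMatrix m m A)]

theorem norm_le_sum_norm (M : CStarMatrix m m A) : ‖M‖ ≤ ∑ i, ∑ j, ‖M i j‖ := by
  classical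
  have h : M = ∑ i, ∑ j, ofMatrix (Matrix.single i j (M i j)) :=
    Matrix.matrix_eq_sum_single (ofMatrix.symm M)
  conv_lhs => rw [h]
  refine (norm_sum_le _ _).trans (Finset.sum_le_sum fun i _ => ?_)
  exact (norm_sum_le _ _).trans (Finset.sum_le_sum fun j _ => norm_single_le i j _)

/-- A crude bound is enough: matrix sizes are fixed before any tolerance is chosen. -/
theorem norm_le_card_mul {M : CStarMatrix m m A} {δ : ℝ} (h : ∀ i j, ‖M i j‖ ≤ δ) :
    ‖M‖ ≤ (Fintype.card m : ℝ) * (Fintype.card m * δ) := by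
  refine (norm_le_sum_norm M).trans ?_
  calc ∑ i, ∑ j, ‖M i j‖ ≤ ∑ _i : m, ∑ _j : m, δ :=
        Finset.sum_le_sum fun i _ => Finset.sum_le_sum fun j _ => h i j
    _ = _ := by simp

/-- The matrix `b ⊗ 1`. -/
def amp (κ : Type*) [DecidableEq κ] (b : CStarMatrix n n A) : CStarMatrix (n × κ) (n × κ) A :=
  ofMatrix (Matrix.blockDiagonal fun _ : κ => ofMatrix.symm b)

section amp
variable [DecidableEq κ]

theorem realScalar_eq_diagonal (r : ℝ) :
    realScalar (CStarMatrix κ κ A) r = ofMatrix (Matrix.diagonal fun _ => realScalar A r) := by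
  ext i j
  rw [realScalar_eq_smul, realScalar_eq_smul, smul_apply, one_apply, ofMatrix_apply,
    Matrix.diagonal_apply]
  split_ifs <;> simp

theorem conj_realScalar (x : Matrix κ m A) (r : ℝ) :
    conj x (realScalar _ r) = r • gram x := by
  rw [← conj_one, ← conj_smul, realScalar_eq_diagonal]
  congr 1
  ext i j
  rw [smul_apply, one_apply, ofMatrix_apply, Matrix.diagonal_apply, realScalar_eq_smul,
    Complex.coe_smul]
  split_ifs <;> simp

theorem amp_mul (a b : CStarMatrix n n A) : amp κ (a * b) = amp κ a * amp κ b :=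
  Matrix.blockDiagonal_mul (fun _ => ofMatrix.symm a) (fun _ : κ => ofMatrix.symm b)

theorem amp_sub (a b : CStarMatrix n n A) : amp κ (a - b) = amp κ a - amp κ b :=
  Matrix.blockDiagonal_sub (fun _ => ofMatrix.symm a) (fun _ : κ => ofMatrix.symm b)

theorem amp_star (a : CStarMatrix n n A) : amp κ (star a) = star (amp κ a) :=
  (Matrix.blockDiagonal_conjTranspose (fun _ : κ => ofMatrix.symm a)).symm

theorem amp_realScalar [DecidableEq n] (r : ℝ) :
    amp κ (realScalar (CStarMatrix n n A) r) = realScalar _ r := by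
  rw [realScalar_eq_diagonal, realScalar_eq_diagonal]
  exact Matrix.blockDiagonal_diagonal fun (_ : κ) (_ : n) => realScalar A r

theorem amp_nonneg {a : CStarMatrix n n A} (ha : 0 ≤ a) : 0 ≤ amp κ a := by
  obtain ⟨y, rfl⟩ := exists_eq_star_mul_self ha
  rw [amp_mul, amp_star]
  exact star_mul_self_nonneg _

theorem amp_mono {a b : CStarMatrix n n A} (h : a ≤ b) : amp κ a ≤ amp κ b := by
  rw [← sub_nonneg, ← amp_sub]
  exact amp_nonneg (sub_nonneg.2 h)

/-- The diagonal matrix with constant diagonal entry `d`. -/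
def scalarDiag (κ : Type*) [DecidableEq κ] (d : A) : CStarMatrix κ κ A :=
  ofMatrix (Matrix.diagonal fun _ => d)

theorem scalarDiag_nonneg {d : A} (hd : 0 ≤ d) : 0 ≤ scalarDiag κ d := by
  obtain ⟨y, rfl⟩ := exists_eq_star_mul_self hd
  have : scalarDiag κ (star y * y) = star (scalarDiag κ y) * scalarDiag κ y := by
    have h : (Matrix.diagonal fun _ : κ => star y * y) =
        (Matrix.diagonal fun _ : κ => y)ᴴ * Matrix.diagonal fun _ => y := by
      rw [Matrix.diagonal_conjTranspose, Matrix.diagonal_mul_diagonal]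
      rfl
    exact h
  rw [this]
  exact star_mul_self_nonneg _

end amp

/-- The block diagonal matrix `diag(a, b)`. -/
def dirSum (a : CStarMatrix m m A) (b : CStarMatrix n n A) : CStarMatrix (m ⊕ n) (m ⊕ n) A :=
  ofMatrix (Matrix.fromBlocks (ofMatrix.symm a) 0 0 (ofMatrix.symm b))

/-- Cuntz subequivalence of square matrices of arbitrary sizes. -/
def CuntzLE (a : CStarMatrix m m A) (b : CStarMatrix n n A) : Prop :=
  RectSubequiv (ofMatrix.symm a) (ofMatrix.symm b)

theorem cuntzLE_iff_mem_closure {a : CStarMatrix m m A} {b : CStarMatrix n n A} :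
    CuntzLE a b ↔ a ∈ closure (Set.range fun x : Matrix n m A => conj x b) := Iff.rfl

theorem cuntzLE_iff {a : CStarMatrix m m A} {b : CStarMatrix n n A} :
    CuntzLE a b ↔ ∀ ε > 0, ∃ x : Matrix n m A, ‖a - conj x b‖ < ε := by
  rw [cuntzLE_iff_mem_closure, Metric.mem_closure_iff]
  refine forall₂_congr fun ε _ => ⟨?_, ?_⟩
  · rintro ⟨_, ⟨x, rfl⟩, h⟩
    exact ⟨x, by rwa [← dist_eq_norm]⟩
  · rintro ⟨x, h⟩
    exact ⟨_, ⟨x, rfl⟩, by rwa [dist_eq_norm]⟩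

theorem cuntzLE_iff_cuntzSubequiv {a b : CStarMatrix n n A} :
    CuntzLE a b ↔ CuntzSubequiv a b := (cuntzSubequiv_iff_mem_closure a b).symm

namespace CuntzLE

theorem trans {a : CStarMatrix l l A} {b : CStarMatrix m m A} {c : CStarMatrix n n A}
    (h₁ : CuntzLE a b) (h₂ : CuntzLE b c) : CuntzLE a c := RectSubequiv.trans h₁ h₂

theorem refl (a : CStarMatrix n n A) : CuntzLE a a :=
  cuntzLE_iff_cuntzSubequiv.2 (CuntzSubequiv.refl a)

theorem of_conj (x : Matrix n m A) (b : CStarMatrix n n A) : CuntzLE (conj x b) b :=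
  subset_closure ⟨x, rfl⟩

theorem of_le {a b : CStarMatrix n n A} (ha : 0 ≤ a) (hab : a ≤ b) : CuntzLE a b := by
  classical
  exact cuntzLE_iff_cuntzSubequiv.2 (CuntzSubequiv.of_le ha hab)

theorem of_le_smul {a b : CStarMatrix n n A} (ha : 0 ≤ a) {r : ℝ} (hr : 0 ≤ r)
    (hab : a ≤ r • b) : CuntzLE a b := by
  classical
  refine (of_le ha hab).trans ?_
  have : r • b = conj (ofMatrix.symm (√r • (1 : CStarMatrix n n A))) b := by
    rw [conj_ofMatrix_symm, star_smul, star_one, smul_mul_assoc, one_mul, mul_smul_comm, mul_one,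
      smul_smul, star_trivial, Real.mul_self_sqrt hr]
  rw [this]
  exact of_conj _ _

theorem cube {a : CStarMatrix n n A} (ha : 0 ≤ a) : CuntzLE a (a * a * a) := by
  classical
  exact cuntzLE_iff_cuntzSubequiv.2 (CuntzSubequiv.cube ha)

theorem of_forall_norm {a : CStarMatrix m m A} {b : CStarMatrix n n A}
    (h : ∀ ε > 0, ∃ c : CStarMatrix m m A, ‖a - c‖ ≤ ε ∧ CuntzLE c b) : CuntzLE a b := by
  rw [cuntzLE_iff_mem_closure, ← closure_closure, Metric.mem_closure_iff]
  intro ε hε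
  obtain ⟨c, hc, hcb⟩ := h (ε / 2) (by positivity)
  exact ⟨c, hcb, by rw [dist_eq_norm]; linarith⟩

/-- Compressing `a - ε ≤ r` by the cut-down `C` of `a` gives `C³ ≤ C r C`, and `C` is subequivalent
to `C³`. Positivity of `r` is not needed. -/
theorem cutDown_of_le_add [DecidableEq m] {a : CStarMatrix m m A} {b : CStarMatrix n n A}
    {r : CStarMatrix m m A} {ε : ℝ} (ha : 0 ≤ a) (hr : CuntzLE r b)
    (h : a ≤ r + realScalar _ ε) : CuntzLE (cutDown a ε) b := by
  have hc := cutDown_nonneg a ε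
  have hcs : IsSelfAdjoint (cutDown a ε) := .of_nonneg hc
  refine (cube hc).trans (CuntzLE.trans ?_
    (CuntzLE.trans (of_conj (ofMatrix.symm (cutDown a ε)) r) hr))
  rw [conj_ofMatrix_symm, hcs.star_eq]
  refine of_le ?_ ?_
  · exact hcs.conjugate_nonneg hc
  · rw [← cutDown_mul_sub_mul_cutDown (.of_nonneg ha)]
    exact hcs.conjugate_le_conjugate (sub_le_iff_le_add.2 h)

theorem of_forall_le_add [DecidableEq m] {a : CStarMatrix m m A} {b : CStarMatrix n n A}
    (ha : 0 ≤ a) (h : ∀ ε > 0, ∃ r : CStarMatrix m m A, CuntzLE r b ∧ a ≤ r + realScalar _ ε) :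
    CuntzLE a b := by
  refine of_forall_norm fun ε hε => ?_
  obtain ⟨r, hr, hle⟩ := h ε hε
  exact ⟨cutDown a ε, norm_sub_cutDown_le ha hε.le, cutDown_of_le_add ha hr hle⟩

/-- The sum is the compression of the block diagonal matrix by the column with two identity blocks.
-/
theorem add_dirSum (a b : CStarMatrix m m A) : CuntzLE (a + b) (dirSum a b) := by
  classical
  have : a + b = conj (Matrix.fromRows (1 : Matrix m m A) (1 : Matrix m m A)) (dirSum a b) := by
    have h : ofMatrix.symm a + ofMatrix.symm b =
        (Matrix.fromRows (1 : Matrix m m A) (1 : Matrix m m A))ᴴ *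
        (Matrix.fromBlocks (ofMatrix.symm a) 0 0 (ofMatrix.symm b)) *
        Matrix.fromRows (1 : Matrix m m A) (1 : Matrix m m A) := by
      rw [Matrix.mul_assoc, Matrix.fromBlocks_mul_fromRows,
        Matrix.conjTranspose_fromRows_eq_fromCols_conjTranspose, Matrix.fromCols_mul_fromRows]
      simp
    exact h
  rw [this]
  exact of_conj _ _

theorem dirSum_le_dirSum {m' n' : Type*} [Fintype m'] [Fintype n'] {a : CStarMatrix m m A}
    {b : CStarMatrix n n A} {a' : CStarMatrix m' m' A} {b' : CStarMatrix n' n' A}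
    (h : CuntzLE a a') (h' : CuntzLE b b') : CuntzLE (dirSum a b) (dirSum a' b') :=
  RectSubequiv.fromBlocks h h'

/-- Compressing `a + b` by the row `(a, b)` gives `diag(a³, b³)`, because orthogonality kills the
mixed terms. -/
theorem dirSum_add {a b : CStarMatrix m m A} (ha : 0 ≤ a) (hb : 0 ≤ b) (hab : a * b = 0) :
    CuntzLE (dirSum a b) (a + b) := by
  have hba : b * a = 0 := by
    have := congrArg star hab
    rwa [star_mul, star_zero, (IsSelfAdjoint.of_nonneg ha).star_eq,
      (IsSelfAdjoint.of_nonneg hb).star_eq] at this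
  refine (dirSum_le_dirSum (cube ha) (cube hb)).trans ?_
  have : dirSum (a * a * a) (b * b * b) =
      conj (Matrix.fromCols (ofMatrix.symm a) (ofMatrix.symm b)) (a + b) := by
    have e1 : a * (a + b) * a = a * a * a := by rw [mul_add, hab, add_zero]
    have e2 : a * (a + b) * b = 0 := by rw [mul_add, hab, add_zero, mul_assoc, hab, mul_zero]
    have e3 : b * (a + b) * a = 0 := by rw [mul_add, hba, zero_add, mul_assoc, hba, mul_zero]
    have e4 : b * (a + b) * b = b * b * b := by rw [mul_add, hba, zero_add]
    have sa : (ofMatrix.symm a)ᴴ = ofMatrix.symm a := (IsSelfAdjoint.of_nonneg ha).star_eq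
    have sb : (ofMatrix.symm b)ᴴ = ofMatrix.symm b := (IsSelfAdjoint.of_nonneg hb).star_eq
    unfold conj
    rw [Matrix.conjTranspose_fromCols_eq_fromRows_conjTranspose, sa, sb, Matrix.fromRows_mul,
      Matrix.fromRows_mul_fromCols]
    unfold dirSum
    congr 1
    exact congr (congr (congr (congrArg _ e1.symm) e2.symm) e3.symm) e4.symm
  rw [this]
  exact of_conj _ _

end CuntzLE

end CStarMatrix
end MatrixAlgebra

/-! ### The Cuntz semigroup in terms of matrices over arbitrary finite index types. -/

section Semigroup

variable {A : Type u} [CStarAlgebra A] [PartialOrder A] [StarOrderedRing A]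

namespace CStarMatrix

namespace CuntzLE

variable {l m n : Type*} [Fintype l] [Fintype m] [Fintype n]

omit [PartialOrder A] [StarOrderedRing A] in
theorem submatrix_left_iff {a : CStarMatrix m m A} {b : CStarMatrix n n A} (e : l ≃ m) :
    CuntzLE (ofMatrix ((ofMatrix.symm a).submatrix e e)) b ↔ CuntzLE a b := by
  refine ⟨fun h => ?_, fun h => RectSubequiv.submatrix_left h e⟩
  have : CuntzLE (ofMatrix (((ofMatrix.symm a).submatrix e e).submatrix e.symm e.symm)) b :=
    RectSubequiv.submatrix_left h e.symm
  simpa only [Matrix.submatrix_submatrix, Equiv.self_comp_symm, Matrix.submatrix_id_id,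
    Equiv.apply_symm_apply] using this

omit [PartialOrder A] [StarOrderedRing A] in
theorem submatrix_right_iff {a : CStarMatrix m m A} {b : CStarMatrix n n A} (e : l ≃ n) :
    CuntzLE a (ofMatrix ((ofMatrix.symm b).submatrix e e)) ↔ CuntzLE a b := by
  refine ⟨fun h => ?_, fun h => RectSubequiv.reindex_right h e⟩
  have : CuntzLE a (ofMatrix (((ofMatrix.symm b).submatrix e e).submatrix e.symm e.symm)) :=
    RectSubequiv.reindex_right h e.symm
  simpa only [Matrix.submatrix_submatrix, Equiv.self_comp_symm, Matrix.submatrix_id_id,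
    Equiv.apply_symm_apply] using this

end CuntzLE

variable {p q r : ℕ}

/-- The class of a positive matrix in the Cuntz semigroup. -/
noncomputable def cuntzClass (a : CStarMatrix (Fin p) (Fin p) A) (ha : 0 ≤ a) : CuntzSemigroup A :=
  CuntzSemigroup.mk ⟨p, a, ha⟩

theorem cuntzClass_le_iff {a : CStarMatrix (Fin p) (Fin p) A} {b : CStarMatrix (Fin q) (Fin q) A}
    {ha : 0 ≤ a} {hb : 0 ≤ b} : cuntzClass a ha ≤ cuntzClass b hb ↔ CuntzLE a b :=
  PosMatrix.le_iff_rectSubequiv _ _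

theorem cuntzClass_add_le_iff {a : CStarMatrix (Fin p) (Fin p) A}
    {b : CStarMatrix (Fin q) (Fin q) A} {c : CStarMatrix (Fin r) (Fin r) A}
    {ha : 0 ≤ a} {hb : 0 ≤ b} {hc : 0 ≤ c} :
    cuntzClass a ha + cuntzClass b hb ≤ cuntzClass c hc ↔ CuntzLE (dirSum a b) c :=
  (PosMatrix.le_iff_rectSubequiv _ _).trans
    (CuntzLE.submatrix_left_iff (a := dirSum a b) (b := c) finSumFinEquiv.symm)

theorem cuntzClass_le_add_iff {a : CStarMatrix (Fin p) (Fin p) A}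
    {b : CStarMatrix (Fin q) (Fin q) A} {c : CStarMatrix (Fin r) (Fin r) A}
    {ha : 0 ≤ a} {hb : 0 ≤ b} {hc : 0 ≤ c} :
    cuntzClass c hc ≤ cuntzClass a ha + cuntzClass b hb ↔ CuntzLE c (dirSum a b) :=
  (PosMatrix.le_iff_rectSubequiv _ _).trans
    (CuntzLE.submatrix_right_iff (a := c) (b := dirSum a b) finSumFinEquiv.symm)

omit [PartialOrder A] [StarOrderedRing A] in
theorem amp_apply {n κ : Type*} [DecidableEq κ] (b : CStarMatrix n n A) (x y : n × κ) :
    amp κ b x y = if x.2 = y.2 then b x.1 y.1 else 0 := rfl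

/-- Multiples in the semigroup are iterated block sums. Up to a permutation of indices, which
comparison ignores, they are amplifications; the newest copy takes the last index. -/
theorem exists_nsmul_cuntzClass (a : CStarMatrix (Fin p) (Fin p) A) (ha : 0 ≤ a) (k : ℕ) :
    ∃ P : PosMatrix A, k • cuntzClass a ha = CuntzSemigroup.mk P ∧
      ∃ e : Fin P.size ≃ Fin p × Fin k, P.mat = ofMatrix ((amp (Fin k) a).submatrix e e) := by
  induction k with
  | zero =>
    refine ⟨0, zero_nsmul _, @Equiv.equivOfIsEmpty (Fin 0) (Fin p × Fin 0) _ _,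
      ext fun i => Fin.elim0 i⟩
  | succ k ih =>
    obtain ⟨P, hP, e, he⟩ := ih
    refine ⟨P + ⟨p, a, ha⟩, ?_, ?_⟩
    · rw [succ_nsmul, hP]
      rfl
    · let e' : (Fin p × Fin k) ⊕ Fin p ≃ Fin p × Fin (k + 1) :=
        { toFun := Sum.elim (fun x => (x.1, x.2.castSucc)) fun i => (i, Fin.last k)
          invFun x := Fin.lastCases (motive := fun _ => (Fin p × Fin k) ⊕ Fin p)
            (.inr x.1) (fun j => .inl (x.1, j)) x.2
          left_inv x := by rcases x with x | x <;> simp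
          right_inv x := by
            rcases x with ⟨x, y⟩
            induction y using Fin.lastCases <;> simp }
      refine ⟨finSumFinEquiv.symm.trans ((Equiv.sumCongr e (Equiv.refl _)).trans e'),
        ext fun i j => ?_⟩
      obtain ⟨i, rfl⟩ := (finSumFinEquiv (m := P.size) (n := p)).surjective i
      obtain ⟨j, rfl⟩ := (finSumFinEquiv (m := P.size) (n := p)).surjective j
      refine (PosMatrix.add_mat_apply P ⟨p, a, ha⟩ i j).trans ?_
      change _ = amp (Fin (k + 1)) a
        (e' (Equiv.sumCongr e (Equiv.refl _) (finSumFinEquiv.symm (finSumFinEquiv i))))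
        (e' (Equiv.sumCongr e (Equiv.refl _) (finSumFinEquiv.symm (finSumFinEquiv j))))
      rw [Equiv.symm_apply_apply, Equiv.symm_apply_apply, amp_apply, he]
      rcases i with i | i <;> rcases j with j | j
      · change amp (Fin k) a (e i) (e j) = _
        rw [amp_apply]
        simp [e']
      · simp [e', (Fin.castSucc_lt_last _).ne]
      · simp [e', (Fin.castSucc_lt_last _).ne']
      · simp [e']

theorem nsmul_cuntzClass_le_iff {a : CStarMatrix (Fin p) (Fin p) A}
    {b : CStarMatrix (Fin q) (Fin q) A} {ha : 0 ≤ a} {hb : 0 ≤ b} {k l : ℕ} :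
    k • cuntzClass a ha ≤ l • cuntzClass b hb ↔ CuntzLE (amp (Fin k) a) (amp (Fin l) b) := by
  obtain ⟨P, hP, e, he⟩ := exists_nsmul_cuntzClass a ha k
  obtain ⟨Q, hQ, f, hf⟩ := exists_nsmul_cuntzClass b hb l
  rw [hP, hQ, CuntzSemigroup.mk_le_mk, PosMatrix.le_iff_rectSubequiv, he, hf]
  exact (CuntzLE.submatrix_left_iff (a := amp (Fin k) a) e).trans
    (CuntzLE.submatrix_right_iff (b := amp (Fin l) b) f)

theorem nsmul_cuntzClass_le_cuntzClass_iff {a : CStarMatrix (Fin p) (Fin p) A}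
    {b : CStarMatrix (Fin q) (Fin q) A} {ha : 0 ≤ a} {hb : 0 ≤ b} {k : ℕ} :
    k • cuntzClass a ha ≤ cuntzClass b hb ↔ CuntzLE (amp (Fin k) a) b := by
  obtain ⟨P, hP, e, he⟩ := exists_nsmul_cuntzClass a ha k
  rw [hP, cuntzClass, CuntzSemigroup.mk_le_mk, PosMatrix.le_iff_rectSubequiv, he]
  exact CuntzLE.submatrix_left_iff (a := amp (Fin k) a) e

end CStarMatrix

theorem almostUnperforated_iff : AlmostUnperforatedCuntzSemigroup A ↔
    ∀ (p q : ℕ) (a : CStarMatrix (Fin p) (Fin p) A) (b : CStarMatrix (Fin q) (Fin q) A),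
      0 ≤ a → 0 ≤ b → ∀ k : ℕ, 1 ≤ k →
      CStarMatrix.CuntzLE (CStarMatrix.amp (Fin (k + 1)) a) (CStarMatrix.amp (Fin k) b) →
      CStarMatrix.CuntzLE a b := by
  constructor
  · intro h p q a b ha hb k hk hab
    have := h (CStarMatrix.cuntzClass a ha) (CStarMatrix.cuntzClass b hb) k hk
      (CStarMatrix.nsmul_cuntzClass_le_iff.2 hab)
    exact CStarMatrix.cuntzClass_le_iff.1 this
  · intro h x y k hk hxy
    obtain ⟨⟨p, a, ha⟩, rfl⟩ := CuntzSemigroup.mk_surjective x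
    obtain ⟨⟨q, b, hb⟩, rfl⟩ := CuntzSemigroup.mk_surjective y
    exact CStarMatrix.cuntzClass_le_iff.2
      (h p q a b ha hb k hk (CStarMatrix.nsmul_cuntzClass_le_iff.1 hxy))

end Semigroup

/-! ### Minimal projections from corners without zero divisors. -/

section MinimalProjection

/-- A minimal projection: `p = p⋆ = p² ≠ 0` and `p D p = ℂ p`. -/
structure IsMinimalProjection {D : Type u} [CStarAlgebra D] (p : D) : Prop where
  isSelfAdjoint : IsSelfAdjoint p
  mul_self : p * p = p
  ne_zero : p ≠ 0
  exists_smul : ∀ y : D, ∃ z : ℂ, p * y * p = z • p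

variable {D : Type u} [CStarAlgebra D]

/-- Two distinct nonzero spectral points of `h = c x c` would carry bump functions with disjoint
supports, giving nonzero elements of `c D c` with product zero. So the spectrum lies in `{0, s}`. -/
theorem exists_mul_self_eq_smul_of_noZeroDivisors {c x : D}
    (hc : ∀ y z : D, c * y * c * (c * z * c) = 0 → c * y * c = 0 ∨ c * z * c = 0)
    (hs : IsSelfAdjoint (c * x * c)) (h0 : c * x * c ≠ 0) :
    ∃ r : ℝ, r ≠ 0 ∧ c * x * c * (c * x * c) = r • (c * x * c) := by
  set h := c * x * c with hh
  have hex : ∃ s ∈ spectrum ℝ h, s ≠ 0 := by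
    by_contra! hcon
    apply h0
    rw [← cfc_id' ℝ h, cfc_congr (g := fun _ => (0 : ℝ)) fun t ht => hcon t ht, cfc_const_zero]
  obtain ⟨s, hs', hs0⟩ := hex
  have key : ∀ t ∈ spectrum ℝ h, t = 0 ∨ t = s := by
    intro t ht
    by_contra! hcon
    obtain ⟨ht0, hts⟩ := hcon
    set δ : ℝ := |s - t| / 2
    have hδ : 0 < δ := by
      have : 0 < |s - t| := abs_pos.2 (sub_ne_zero.2 hts.symm)
      positivity
    -- The outer factors `y` become copies of `h = c x c`, which put the function of `h` into `c D
    -- c`.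
    have hform : ∀ w : ℝ, cfc (fun y : ℝ => y * max 0 (δ - |y - w|) * y) h =
        c * (x * c * cfc (fun y : ℝ => max 0 (δ - |y - w|)) h * c * x) * c := by
      intro w
      have : cfc (fun y : ℝ => y * max 0 (δ - |y - w|) * y) h =
          h * cfc (fun y : ℝ => max 0 (δ - |y - w|)) h * h := by
        rw [cfc_mul (fun y : ℝ => y * max 0 (δ - |y - w|)) (fun y => y) h,
          cfc_mul (fun y : ℝ => y) (fun y => max 0 (δ - |y - w|)) h, cfc_id' ℝ h]
      rw [this, hh]
      simp only [mul_assoc]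
    have hne : ∀ w ∈ spectrum ℝ h, w ≠ 0 →
        cfc (fun y : ℝ => y * max 0 (δ - |y - w|) * y) h ≠ 0 := by
      intro w hw hw0 hz
      rw [← cfc_const_zero ℝ h] at hz
      have := eqOn_of_cfc_eq_cfc (a := h) hz (by fun_prop) (by fun_prop) hs hw
      simp [hw0, max_eq_right hδ.le, hδ.ne'] at this
    have hmul : cfc (fun y : ℝ => y * max 0 (δ - |y - s|) * y) h *
        cfc (fun y : ℝ => y * max 0 (δ - |y - t|) * y) h = 0 := by
      rw [← cfc_mul _ _ h, ← cfc_const_zero ℝ h]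
      refine cfc_congr fun y _ => ?_
      have : max 0 (δ - |y - s|) = 0 ∨ max 0 (δ - |y - t|) = 0 := by
        by_contra! hcon
        have h1 : 0 < δ - |y - s| := by
          by_contra hn
          exact hcon.1 (max_eq_left (not_lt.1 hn))
        have h2 : 0 < δ - |y - t| := by
          by_contra hn
          exact hcon.2 (max_eq_left (not_lt.1 hn))
        have h3 : |s - t| ≤ |y - s| + |y - t| := by
          rw [abs_sub_comm y s]
          exact abs_sub_le s y t
        have h4 : δ + δ = |s - t| := add_halves _
        linarith
      rcases this with h1 | h1 <;> simp [h1]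
    have hor := hmul
    rw [hform, hform] at hor
    rcases hc _ _ hor with h1 | h1
    · rw [← hform] at h1
      exact hne s hs' hs0 h1
    · rw [← hform] at h1
      exact hne t ht ht0 h1
  refine ⟨s, hs0, ?_⟩
  have e1 : h * h = cfc (fun y : ℝ => y * y) h := by
    rw [cfc_mul (fun y : ℝ => y) (fun y => y) h, cfc_id' ℝ h]
  have e2 : s • h = cfc (fun y : ℝ => s • y) h := by
    rw [cfc_smul s (fun y : ℝ => y) h, cfc_id' ℝ h]
  rw [e1, e2]
  refine cfc_congr fun y hy => ?_
  rcases key y hy with rfl | rfl <;> simp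

/-- A real multiple `p` of `c²` is a projection. For self-adjoint `y`, `h = p y p` is either zero or
satisfies `h² = t h`; then `(t p - h) h = 0` inside `c D c`, which forces `h = t p`. Real and
imaginary parts give general `y`. -/
theorem exists_isMinimalProjection_of_noZeroDivisors {c : D} (hcs : IsSelfAdjoint c) (hc0 : c ≠ 0)
    (hc : ∀ y z : D, c * y * c * (c * z * c) = 0 → c * y * c = 0 ∨ c * z * c = 0) :
    ∃ p : D, IsMinimalProjection p := by
  have hcc : c * 1 * c ≠ 0 := by
    rw [mul_one]
    intro h
    have := CStarRing.norm_star_mul_self (x := c)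
    rw [hcs.star_eq, h, norm_zero] at this
    exact hc0 (norm_eq_zero.1 (mul_self_eq_zero.1 this.symm))
  have hccs : IsSelfAdjoint (c * 1 * c) := by
    rw [mul_one]
    rw [IsSelfAdjoint, star_mul, hcs.star_eq]
  obtain ⟨r, hr0, hr⟩ := exists_mul_self_eq_smul_of_noZeroDivisors hc hccs hcc
  set p : D := r⁻¹ • (c * 1 * c) with hp
  have hps : IsSelfAdjoint p := (IsSelfAdjoint.all _).smul hccs
  have hpp : p * p = p := by
    rw [hp, smul_mul_smul_comm, hr, smul_smul, mul_assoc, inv_mul_cancel₀ hr0, mul_one]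
  have hp0 : p ≠ 0 := smul_ne_zero (inv_ne_zero hr0) hcc
  have hform : ∀ y : D, p * y * p = c * (r⁻¹ • (c * y * (r⁻¹ • c))) * c := by
    intro y
    rw [hp]
    simp [mul_assoc]
  have hpf : p = c * (r⁻¹ • (1 : D)) * c := by rw [hp]; simp
  have hsa : ∀ y : D, IsSelfAdjoint y → ∃ t : ℝ, p * y * p = t • p := by
    intro y hy
    by_cases h0 : p * y * p = 0
    · exact ⟨0, by simp [h0]⟩
    have hys : IsSelfAdjoint (p * y * p) := by
      simpa [hps.star_eq] using hy.conjugate p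
    have hys' := hys
    have h0' := h0
    rw [hform] at hys' h0'
    obtain ⟨t, ht0, ht⟩ := exists_mul_self_eq_smul_of_noZeroDivisors hc hys' h0'
    rw [← hform] at ht
    refine ⟨t, ?_⟩
    have hz : (t • p - p * y * p) * (p * y * p) = 0 := by
      rw [sub_mul, ht, smul_mul_assoc, ← mul_assoc, ← mul_assoc, hpp, sub_self]
    have hf : t • p - p * y * p =
        c * (t • r⁻¹ • (1 : D) - r⁻¹ • (c * y * (r⁻¹ • c))) * c := by
      rw [hform, mul_sub, sub_mul, mul_smul_comm t, smul_mul_assoc t, ← hpf]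
    rw [hf, hform] at hz
    rcases hc _ _ hz with h1 | h1
    · rw [← hf] at h1
      exact (sub_eq_zero.1 h1).symm
    · exact absurd h1 h0'
  clear_value p
  refine ⟨p, hps, hpp, hp0, fun y => ?_⟩
  obtain ⟨t₁, h₁⟩ := hsa (realPart y) (realPart y).2
  obtain ⟨t₂, h₂⟩ := hsa (imaginaryPart y) (imaginaryPart y).2
  refine ⟨t₁ + Complex.I * t₂, ?_⟩
  conv_lhs => rw [← realPart_add_I_smul_imaginaryPart y]
  rw [mul_add, add_mul, mul_smul_comm, smul_mul_assoc, h₁, h₂, add_smul, mul_smul,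
    Complex.coe_smul, Complex.coe_smul]

end MinimalProjection

/-! ### Ideals and primeness in simple algebras and their matrix algebras. -/

section SimpleAlgebra

variable {A : Type u} [CStarAlgebra A]

/-- In a simple unital C⋆-algebra every nonzero element generates the algebra as an ideal. -/
theorem IsSimpleCStarAlgebra.one_mem_span (hA : IsSimpleCStarAlgebra A) {p : A} (hp : p ≠ 0) :
    (1 : A) ∈ AddSubgroup.closure (Set.range fun w : A × A => w.1 * p * w.2) := by
  set S := AddSubgroup.closure (Set.range fun w : A × A => w.1 * p * w.2) with hS
  have hl : ∀ x y : A, y ∈ S → x * y ∈ S := by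
    intro x y hy
    have : S ≤ S.comap (AddMonoidHom.mulLeft x) := by
      rw [hS, AddSubgroup.closure_le]
      rintro _ ⟨w, rfl⟩
      exact AddSubgroup.subset_closure ⟨(x * w.1, w.2), by simp [mul_assoc]⟩
    exact this hy
  have hr : ∀ x y : A, x ∈ S → x * y ∈ S := by
    intro x y hx
    have : S ≤ S.comap (AddMonoidHom.mulRight y) := by
      rw [hS, AddSubgroup.closure_le]
      rintro _ ⟨w, rfl⟩
      exact AddSubgroup.subset_closure ⟨(w.1, w.2 * y), by simp [mul_assoc]⟩
    exact this hx
  let I : TwoSidedIdeal A := TwoSidedIdeal.mk' (S.topologicalClosure : Set A)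
    S.topologicalClosure.zero_mem S.topologicalClosure.add_mem S.topologicalClosure.neg_mem
    (fun {x y} hy => map_mem_closure (f := fun y => x * y) (by fun_prop) hy fun z hz => hl x z hz)
    (fun {x y} hx => map_mem_closure (f := fun x => x * y) (by fun_prop) hx fun z hz => hr z y hz)
  have hI : (I : Set A) = closure (S : Set A) := TwoSidedIdeal.coe_mk' ..
  have hpI : p ∈ I := by
    rw [← SetLike.mem_coe, hI]
    exact subset_closure (AddSubgroup.subset_closure ⟨(1, 1), by simp⟩)
  have hone : (1 : A) ∈ closure (S : Set A) := by
    rcases hA.2 I (by rw [hI]; exact isClosed_closure) with h | h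
    · rw [h, TwoSidedIdeal.mem_bot] at hpI
      exact absurd hpI hp
    · rw [← hI, h]
      exact TwoSidedIdeal.mem_top ..
  rw [Metric.mem_closure_iff] at hone
  obtain ⟨s, hs, hd⟩ := hone 1 one_pos
  rw [dist_eq_norm] at hd
  -- An element of the algebraic ideal at distance less than `1` from the unit is invertible, so no
  -- closure is needed.
  have hu : IsUnit s := by
    have := isUnit_one_sub_of_norm_lt_one hd
    rwa [sub_sub_cancel] at this
  obtain ⟨v, rfl⟩ := hu
  have := hl ((v⁻¹ : Aˣ) : A) v hs
  rwa [Units.inv_mul] at this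

/-- A simple unital C⋆-algebra is prime. -/
theorem IsSimpleCStarAlgebra.exists_mul_mul_ne_zero (hA : IsSimpleCStarAlgebra A) {x y : A}
    (hx : x ≠ 0) (hy : y ≠ 0) : ∃ z, x * z * y ≠ 0 := by
  by_contra! h
  have : (1 : A) ∈ (AddMonoidHom.mulRight y).ker := by
    refine (AddSubgroup.closure_le _).2 ?_ (hA.one_mem_span hx)
    rintro _ ⟨w, rfl⟩
    change w.1 * x * w.2 * y = 0
    rw [mul_assoc, mul_assoc, ← mul_assoc x, h, mul_zero]
  rw [AddMonoidHom.mem_ker] at this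
  simp at this
  exact hy this

theorem IsSimpleCStarAlgebra.exists_sum_eq_one (hA : IsSimpleCStarAlgebra A) {p : A} (hp : p ≠ 0) :
    ∃ (N : ℕ) (x y : Fin N → A), ∑ i, x i * p * y i = 1 := by
  have := hA.one_mem_span hp
  generalize (1 : A) = o at this ⊢
  induction this using AddSubgroup.closure_induction with
  | mem x hx =>
    obtain ⟨w, rfl⟩ := hx
    exact ⟨1, fun _ => w.1, fun _ => w.2, by simp⟩
  | zero => exact ⟨0, 0, 0, by simp⟩
  | add a b _ _ ha hb =>
    obtain ⟨N, x, y, rfl⟩ := ha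
    obtain ⟨M, x', y', rfl⟩ := hb
    exact ⟨N + M, Fin.append x x', Fin.append y y', by simp [Fin.sum_univ_add]⟩
  | neg a _ ha =>
    obtain ⟨N, x, y, rfl⟩ := ha
    exact ⟨N, fun i => - x i, y, by simp⟩

end SimpleAlgebra

section Prime

variable {A : Type u} [CStarAlgebra A] {n : Type*} [Fintype n]

/-- Primeness of `A` applied to a nonzero entry of each matrix gives a `z`, placed at the position
linking the two entries. -/
theorem CStarMatrix.exists_mul_mul_ne_zero (hA : IsSimpleCStarAlgebra A)
    {x y : CStarMatrix n n A} (hx : x ≠ 0) (hy : y ≠ 0) : ∃ z, x * z * y ≠ 0 := by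
  classical
  obtain ⟨i, j, hij⟩ : ∃ i j, x i j ≠ 0 := by
    by_contra! h
    exact hx (ext h)
  obtain ⟨k, l, hkl⟩ : ∃ k l, y k l ≠ 0 := by
    by_contra! h
    exact hy (ext h)
  obtain ⟨z, hz⟩ := hA.exists_mul_mul_ne_zero hij hkl
  refine ⟨ofMatrix (Matrix.single j k z), fun h => hz ?_⟩
  have h' := congrFun (congrFun h i) l
  have : (x * ofMatrix (Matrix.single j k z) * y) i l = x i j * z * y k l := by
    have h1 : ((ofMatrix.symm x) * (Matrix.single j k z) * (ofMatrix.symm y)) i l =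
        x i j * z * y k l := by
      rw [Matrix.mul_apply, Finset.sum_eq_single k]
      · simp
      · intro b _ hb
        simp [hb]
      · simp
    exact h1
  rw [← this, h']
  rfl

variable [DecidableEq n] [PartialOrder A] [StarOrderedRing A]

/-- Each diagonal entry satisfies `p_ii = ∑ p_ki⋆ p_ki`, so some `p_ii` is nonzero. Minimality
tested on matrices supported at `(i, i)` gives `p_ii A p_ii = ℂ p_ii`, and a real multiple of `p_ii`
is the projection sought. -/
theorem IsMinimalProjection.of_cstarMatrix {p : CStarMatrix n n A} (hp : IsMinimalProjection p) :
    ∃ p₀ : A, IsMinimalProjection p₀ := by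
  obtain ⟨i, hi⟩ : ∃ i, p i i ≠ 0 := by
    by_contra! h
    apply hp.ne_zero
    ext j i
    have h1 : p i i = ∑ k, star (p k i) * p k i := by
      conv_lhs => rw [← hp.mul_self]
      nth_rewrite 1 [← hp.isSelfAdjoint.star_eq]
      rfl
    rw [h i] at h1
    have h2 := (Finset.sum_eq_zero_iff_of_nonneg fun k _ => star_mul_self_nonneg (p k i)).1
      h1.symm j (Finset.mem_univ _)
    exact (CStarRing.star_mul_self_eq_zero_iff _).1 h2
  have hsa : IsSelfAdjoint (p i i) := by
    have := congrFun (congrFun hp.isSelfAdjoint.star_eq i) i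
    exact this
  have hex : ∀ y : A, ∃ z : ℂ, p i i * y * p i i = z • p i i := by
    intro y
    obtain ⟨z, hz⟩ := hp.exists_smul (CStarMatrix.ofMatrix (Matrix.single i i y))
    refine ⟨z, ?_⟩
    have h' := congrFun (congrFun hz i) i
    have : (p * CStarMatrix.ofMatrix (Matrix.single i i y) * p) i i = p i i * y * p i i := by
      have h1 : ((CStarMatrix.ofMatrix.symm p) * (Matrix.single i i y) *
          (CStarMatrix.ofMatrix.symm p)) i i = p i i * y * p i i := by
        rw [Matrix.mul_apply, Finset.sum_eq_single i]
        · simp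
        · intro b _ hb
          simp [hb]
        · simp
      exact h1
    rw [← this, h']
    rfl
  obtain ⟨z, hz⟩ := hex 1
  rw [mul_one] at hz
  have hz0 : z ≠ 0 := by
    rintro rfl
    rw [zero_smul] at hz
    exact hi ((CStarRing.star_mul_self_eq_zero_iff _).1 (by rwa [hsa.star_eq]))
  have hzs : star z = z := by
    have := congrArg star hz
    rw [star_mul, hsa.star_eq, star_smul, hsa.star_eq, hz] at this
    exact (smul_left_injective ℂ hi this).symm
  refine ⟨z⁻¹ • p i i, ?_, ?_, smul_ne_zero (inv_ne_zero hz0) hi, fun y => ?_⟩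
  · rw [IsSelfAdjoint, star_smul, hsa.star_eq, star_inv₀, hzs]
  · rw [smul_mul_smul_comm, hz, smul_smul, mul_assoc, inv_mul_cancel₀ hz0, mul_one]
  · obtain ⟨w, hw⟩ := hex y
    refine ⟨z⁻¹ * w, ?_⟩
    rw [smul_mul_assoc, smul_mul_assoc, mul_smul_comm, hw, smul_smul, smul_smul, smul_smul]
    congr 1
    ring

end Prime

/-! ### Ranks of positive matrices in the presence of a minimal projection. -/

section MinimalProjectionRank

set_option linter.unusedSectionVars false

variable {A : Type u} [CStarAlgebra A] [PartialOrder A] [StarOrderedRing A] {p : A}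

/-- The diagonal matrix with constant diagonal entry `d`. -/
abbrev constDiagonal (ι : Type*) [DecidableEq ι] (d : A) : Matrix ι ι A :=
  Matrix.diagonal fun _ => d

namespace IsMinimalProjection

variable {n ι κ : Type*} [Fintype n] [Fintype ι] [DecidableEq ι] [Fintype κ] [DecidableEq κ]

/-- This functional is multiplicative across `p`, that is `φ(x p y) = φ(x) φ(y)`. Applied entrywise
it turns factorizations through copies of `p` into products of complex matrices, where rank is
available. -/
theorem exists_functional (hp : IsMinimalProjection p) :
    ∃ φ : A →ₗ[ℂ] ℂ, Continuous φ ∧ ∀ x, p * x * p = φ x • p := by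
  choose φ hφ using hp.exists_smul
  have hinj : ∀ z w : ℂ, z • p = w • p → z = w := fun z w h => smul_left_injective ℂ hp.ne_zero h
  let φ' : A →ₗ[ℂ] ℂ :=
    { toFun := φ
      map_add' x y := hinj _ _ (by rw [← hφ, add_smul, ← hφ, ← hφ, mul_add, add_mul])
      map_smul' z x := hinj _ _ (by
        rw [← hφ, mul_smul_comm, smul_mul_assoc, hφ, smul_smul]
        rfl) }
  refine ⟨φ', ?_, hφ⟩
  have hp0 : 0 < ‖p‖ := norm_pos_iff.2 hp.ne_zero
  refine AddMonoidHomClass.continuous_of_bound φ' (‖p‖⁻¹ * (‖p‖ * ‖p‖)) fun x => ?_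
  have h1 : ‖φ x‖ * ‖p‖ = ‖p * x * p‖ := by rw [hφ, norm_smul]
  have h2 : ‖p * x * p‖ ≤ ‖p‖ * ‖x‖ * ‖p‖ :=
    (norm_mul_le _ _).trans (by gcongr; exact norm_mul_le _ _)
  change ‖φ x‖ ≤ _
  rw [← h1] at h2
  rw [mul_assoc, inv_mul_eq_div, le_div_iff₀ hp0]
  linarith

theorem functional_mul {φ : A →ₗ[ℂ] ℂ} (hp : IsMinimalProjection p)
    (hφ : ∀ x, p * x * p = φ x • p) (x y : A) : φ (x * p * y) = φ x * φ y := by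
  refine smul_left_injective ℂ hp.ne_zero ?_
  change φ (x * p * y) • p = (φ x * φ y) • p
  have h : p * (x * p * y) * p = p * x * p * (p * y * p) := by
    have : p * x * p * (p * y * p) = p * x * (p * p) * y * p := by simp only [mul_assoc]
    rw [this, hp.mul_self]
    simp only [mul_assoc]
  rw [← hφ, h, hφ, hφ, smul_mul_smul_comm, hp.mul_self]

theorem functional_star {φ : A →ₗ[ℂ] ℂ} (hp : IsMinimalProjection p)
    (hφ : ∀ x, p * x * p = φ x • p) (x : A) : φ (star x) = star (φ x) := by
  refine smul_left_injective ℂ hp.ne_zero ?_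
  change φ (star x) • p = star (φ x) • p
  have := congrArg star (hφ x)
  rw [star_mul, star_mul, star_smul, hp.isSelfAdjoint.star_eq, ← mul_assoc, hφ] at this
  exact this

theorem functional_self {φ : A →ₗ[ℂ] ℂ} (hp : IsMinimalProjection p)
    (hφ : ∀ x, p * x * p = φ x • p) : φ p = 1 := by
  refine smul_left_injective ℂ hp.ne_zero ?_
  change φ p • p = (1 : ℂ) • p
  rw [← hφ, hp.mul_self, hp.mul_self, one_smul]

theorem map_mul_scalarDiag_mul {φ : A →ₗ[ℂ] ℂ} (hp : IsMinimalProjection p)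
    (hφ : ∀ x, p * x * p = φ x • p) (U : Matrix κ ι A) (V : Matrix ι κ A) :
    (U * constDiagonal ι p * V).map φ = U.map φ * V.map φ := by
  ext i j
  rw [Matrix.map_apply, Matrix.mul_apply, map_sum, Matrix.mul_apply]
  refine Finset.sum_congr rfl fun k _ => ?_
  rw [Matrix.mul_diagonal, hp.functional_mul hφ]
  rfl

theorem map_diagonal {φ : A →ₗ[ℂ] ℂ} (hp : IsMinimalProjection p)
    (hφ : ∀ x, p * x * p = φ x • p) :
    (constDiagonal κ p).map φ = 1 := by
  rw [Matrix.diagonal_map (map_zero φ), hp.functional_self hφ]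
  exact Matrix.diagonal_one

theorem card_le_of_isUnit_det {U : Matrix κ ι ℂ} {V : Matrix ι κ ℂ} (h : (U * V).det ≠ 0) :
    Fintype.card κ ≤ Fintype.card ι := by
  have h1 := Matrix.rank_of_isUnit (U * V) ((Matrix.isUnit_iff_isUnit_det _).2 h.isUnit)
  rw [← h1]
  exact (Matrix.rank_mul_le_left U V).trans (Matrix.rank_le_card_width U)

theorem card_le_of_eq_mul (hp : IsMinimalProjection p) {U : Matrix κ ι A} {V : Matrix ι κ A}
    (h : constDiagonal κ p = U * constDiagonal ι p * V) :
    Fintype.card κ ≤ Fintype.card ι := by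
  obtain ⟨φ, -, hφ⟩ := hp.exists_functional
  have := congrArg (fun M => M.map φ) h
  rw [hp.map_diagonal hφ, hp.map_mul_scalarDiag_mul hφ] at this
  refine card_le_of_isUnit_det (U := U.map φ) (V := V.map φ) ?_
  rw [← this]
  simp

/-- Under `φ` the complex identity becomes a limit of matrices `W⋆ W`. Invertibility is an open
condition, so one of them is invertible, and its rank is at most the number of rows of `W`. -/
theorem card_le_of_cuntzLE (hp : IsMinimalProjection p)
    (h : CStarMatrix.CuntzLE (CStarMatrix.scalarDiag κ p) (CStarMatrix.scalarDiag ι p)) :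
    Fintype.card κ ≤ Fintype.card ι := by
  obtain ⟨φ, hc, hφ⟩ := hp.exists_functional
  have hcont : Continuous fun M : Matrix κ κ A => M.map φ := continuous_id.matrix_map hc
  have h1 : (1 : Matrix κ κ ℂ) ∈ closure (Set.range fun W : Matrix ι κ ℂ => Wᴴ * W) := by
    rw [← hp.map_diagonal hφ]
    refine map_mem_closure (f := fun M : Matrix κ κ A => M.map φ) hcont h ?_
    rintro _ ⟨x, rfl⟩
    refine ⟨x.map φ, ?_⟩
    refine Eq.trans ?_ (hp.map_mul_scalarDiag_mul hφ xᴴ x).symm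
    have h2 : (x.map φ)ᴴ = xᴴ.map φ := by
      ext i j
      exact (hp.functional_star hφ _).symm
    change (x.map φ)ᴴ * x.map φ = xᴴ.map φ * x.map φ
    rw [h2]
  have ho : IsOpen {M : Matrix κ κ ℂ | M.det ≠ 0} :=
    isOpen_ne.preimage (Continuous.matrix_det continuous_id)
  obtain ⟨_, hM, ⟨W, rfl⟩⟩ := mem_closure_iff.1 h1 _ ho (by simp)
  exact card_le_of_isUnit_det hM

/-- The identity `∑ x_i p y_i = 1` factors the unit matrix of size `n` through `n · N` copies of
`p`. This bounds how many copies a matrix of that size can compress to. -/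
theorem card_le_of_conj_eq (hp : IsMinimalProjection p) [DecidableEq n] {N : ℕ} {x y : Fin N → A}
    (hxy : ∑ i, x i * p * y i = 1) {b : CStarMatrix n n A} {v : Matrix n κ A}
    (h : CStarMatrix.conj v b = CStarMatrix.scalarDiag κ p) :
    Fintype.card κ ≤ Fintype.card n * N := by
  let X : Matrix n (n × Fin N) A := Matrix.of fun i j => if i = j.1 then x j.2 else 0
  let Y : Matrix (n × Fin N) n A := Matrix.of fun j i => if j.1 = i then y j.2 else 0
  have hXY : X * constDiagonal (n × Fin N) p * Y = 1 := by
    ext i j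
    rw [Matrix.mul_apply, Fintype.sum_prod_type]
    simp only [Matrix.mul_diagonal, X, Y, Matrix.of_apply]
    rw [Finset.sum_eq_single i]
    · by_cases hij : i = j
      · subst hij
        simp [hxy]
      · simp [hij]
    · intro k _ hk
      simp [hk.symm]
    · simp
  have : constDiagonal κ p =
      (vᴴ * CStarMatrix.ofMatrix.symm b * X) * constDiagonal (n × Fin N) p * (Y * v) := by
    have h' : vᴴ * CStarMatrix.ofMatrix.symm b * v = constDiagonal κ p := h
    calc _ = vᴴ * CStarMatrix.ofMatrix.symm b * (X * constDiagonal (n × Fin N) p * Y) * v := by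
          rw [hXY, Matrix.mul_one, h']
      _ = _ := by simp only [Matrix.mul_assoc]
  simpa using hp.card_le_of_eq_mul this

/-- A Gram–Schmidt step for the form `w⋆ b w`: since `p A p = ℂ p`, a column `w = w p` has `w⋆ b w =
r p` with `r > 0`, and dividing by `√r` adjoins it to the orthonormal system `v`. -/
theorem exists_conj_eq_of_ne_zero (hp : IsMinimalProjection p) {b : CStarMatrix n n A} (hb : 0 ≤ b)
    {v : Matrix n κ A} (hv : CStarMatrix.conj v b = CStarMatrix.scalarDiag κ p)
    {w : Matrix n Unit A} (hw : w * constDiagonal Unit p = w)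
    (hvw : vᴴ * CStarMatrix.ofMatrix.symm b * w = 0) (hww : CStarMatrix.conj w b ≠ 0) :
    ∃ v' : Matrix n (κ ⊕ Unit) A, CStarMatrix.conj v' b = CStarMatrix.scalarDiag (κ ⊕ Unit) p := by
  set B : Matrix n n A := CStarMatrix.ofMatrix.symm b with hB
  have hBs : Bᴴ = B := (IsSelfAdjoint.of_nonneg hb).star_eq
  have hv' : vᴴ * B * v = constDiagonal κ p := hv
  set g : A := (wᴴ * B * w) () () with hg
  have hPs : (constDiagonal Unit p)ᴴ = constDiagonal Unit p := by
    rw [Matrix.diagonal_conjTranspose]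
    congr 1
    ext
    exact hp.isSelfAdjoint.star_eq
  have hgp : p * g * p = g := by
    have h1 : wᴴ * B * w = constDiagonal Unit p * (wᴴ * B * w) * constDiagonal Unit p := by
      conv_lhs => rw [← hw, Matrix.conjTranspose_mul, hPs]
      simp only [Matrix.mul_assoc]
    have h2 := congrFun (congrFun h1 ()) ()
    rw [Matrix.mul_diagonal, Matrix.diagonal_mul] at h2
    exact h2.symm
  have hg0 : g ≠ 0 := fun h => hww (CStarMatrix.ext fun i j => h)
  obtain ⟨y, hy⟩ := exists_eq_star_mul_self hb
  have hgn : 0 ≤ g := by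
    have h1 : wᴴ * B * w =
        (CStarMatrix.ofMatrix.symm y * w)ᴴ * (CStarMatrix.ofMatrix.symm y * w) := by
      have h2 : B = (CStarMatrix.ofMatrix.symm y)ᴴ * CStarMatrix.ofMatrix.symm y := hy
      rw [h2, Matrix.conjTranspose_mul]
      simp only [Matrix.mul_assoc]
    rw [hg, h1, Matrix.mul_apply]
    exact Finset.sum_nonneg fun k _ => star_mul_self_nonneg _
  obtain ⟨z, hz⟩ := hp.exists_smul g
  rw [hgp] at hz
  have hzs : star z = z := by
    have h1 := (IsSelfAdjoint.of_nonneg hgn).star_eq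
    rw [hz, star_smul, hp.isSelfAdjoint.star_eq] at h1
    exact smul_left_injective ℂ hp.ne_zero h1
  obtain ⟨r, rfl⟩ := Complex.conj_eq_iff_real.1 hzs
  rw [Complex.coe_smul] at hz
  have hr0 : r ≠ 0 := by
    rintro rfl
    exact hg0 (by rw [hz, zero_smul])
  have hpn : 0 ≤ p := by
    rw [← hp.mul_self]
    nth_rewrite 1 [← hp.isSelfAdjoint.star_eq]
    exact star_mul_self_nonneg _
  have hr : 0 < r := by
    by_contra hr
    have h1 : 0 ≤ (-r) • p := smul_nonneg (by linarith) hpn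
    rw [neg_smul, ← hz] at h1
    exact hg0 (le_antisymm (neg_nonneg.1 h1) hgn)
  set w' : Matrix n Unit A := (√r)⁻¹ • w with hw'
  refine ⟨Matrix.fromCols v w', ?_⟩
  have e1 : vᴴ * B * w' = 0 := by rw [hw', Matrix.mul_smul, hvw, smul_zero]
  have e2 : w'ᴴ * B * v = 0 := by
    have := congrArg Matrix.conjTranspose e1
    rwa [Matrix.conjTranspose_mul, Matrix.conjTranspose_mul, hBs,
      Matrix.conjTranspose_conjTranspose,
      Matrix.conjTranspose_zero, ← Matrix.mul_assoc] at this
  have e3 : w'ᴴ * B * w' = constDiagonal Unit p := by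
    ext ⟨⟩ ⟨⟩
    rw [hw', Matrix.mul_smul, Matrix.conjTranspose_smul, Matrix.smul_mul, Matrix.smul_mul,
      smul_smul,
      Matrix.smul_apply, ← hg, hz, smul_smul, star_trivial, ← mul_inv, Real.mul_self_sqrt hr.le,
      inv_mul_cancel₀ hr0, one_smul]
    simp
  have e : (Matrix.fromCols v w')ᴴ * B * Matrix.fromCols v w' = constDiagonal (κ ⊕ Unit) p := by
    rw [Matrix.conjTranspose_fromCols_eq_fromRows_conjTranspose, Matrix.fromRows_mul,
      Matrix.fromRows_mul_fromCols, hv', e1, e2, e3, Matrix.fromBlocks_diagonal]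
    congr 1
    ext i
    cases i <;> rfl
  exact e

/-- Take `r` maximal with `v⋆ b v = p ⊗ 1_r`. By maximality and Gram–Schmidt, `b - b v v⋆ b`
annihilates every column `w = w p`; by primeness it is zero. So `b` and `p ⊗ 1_r` are compressions
of each other. -/
theorem exists_cuntzLE_scalarDiag (hA : IsSimpleCStarAlgebra A) (hp : IsMinimalProjection p) {q : ℕ}
    {b : CStarMatrix (Fin q) (Fin q) A} (hb : 0 ≤ b) :
    ∃ r : ℕ, CStarMatrix.CuntzLE b (CStarMatrix.scalarDiag (Fin r) p) ∧
      CStarMatrix.CuntzLE (CStarMatrix.scalarDiag (Fin r) p) b := by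
  obtain ⟨N, x, y, hxy⟩ := hA.exists_sum_eq_one hp.ne_zero
  let S : Set ℕ := {r | ∃ v : Matrix (Fin q) (Fin r) A,
    CStarMatrix.conj v b = CStarMatrix.scalarDiag (Fin r) p}
  have hS : BddAbove S := by
    refine ⟨q * N, ?_⟩
    rintro r ⟨v, hv⟩
    simpa using hp.card_le_of_conj_eq hxy hv
  have hS0 : S.Nonempty := ⟨0, 0, CStarMatrix.ext fun i => Fin.elim0 i⟩
  obtain ⟨r, ⟨v₀, hv₀⟩, hmax⟩ : ∃ r ∈ S, ∀ t ∈ S, t ≤ r :=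
    ⟨_, Nat.sSup_mem hS0 hS, fun t ht => le_csSup hS ht⟩
  set B : Matrix (Fin q) (Fin q) A := CStarMatrix.ofMatrix.symm b with hB
  have hBs : Bᴴ = B := (IsSelfAdjoint.of_nonneg hb).star_eq
  have hPs : ∀ (ι : Type) [Fintype ι] [DecidableEq ι],
      (constDiagonal ι p)ᴴ = constDiagonal ι p := by
    intro ι _ _
    rw [Matrix.diagonal_conjTranspose]
    congr 1
    ext
    exact hp.isSelfAdjoint.star_eq
  have hPP : ∀ (ι : Type) [Fintype ι] [DecidableEq ι],
      constDiagonal ι p * constDiagonal ι p = constDiagonal ι p := by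
    intro ι _ _
    rw [Matrix.diagonal_mul_diagonal, hp.mul_self]
  set v : Matrix (Fin q) (Fin r) A := v₀ * constDiagonal (Fin r) p with hv
  have hvP : v * constDiagonal (Fin r) p = v := by rw [hv, Matrix.mul_assoc, hPP]
  have hPv : constDiagonal (Fin r) p * vᴴ = vᴴ := by
    conv_rhs => rw [← hvP, Matrix.conjTranspose_mul, hPs]
  have hv₀' : v₀ᴴ * B * v₀ = constDiagonal (Fin r) p := hv₀
  have hvb : vᴴ * B * v = constDiagonal (Fin r) p := by
    calc vᴴ * B * v = constDiagonal (Fin r) p * (v₀ᴴ * B * v₀) * constDiagonal (Fin r) p := by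
          rw [hv, Matrix.conjTranspose_mul, hPs]
          simp only [Matrix.mul_assoc]
      _ = _ := by rw [hv₀', hPP, hPP]
  clear_value v
  obtain ⟨s, hs⟩ := exists_eq_star_mul_self hb
  have hs' : B = (CStarMatrix.ofMatrix.symm s)ᴴ * CStarMatrix.ofMatrix.symm s := hs
  have key : ∀ w : Matrix (Fin q) Unit A, w * constDiagonal Unit p = w →
      (B - B * v * (vᴴ * B)) * w = 0 := by
    intro w hw
    -- The part of `w` orthogonal to `v` for the form defined by `b`.
    set w' : Matrix (Fin q) Unit A := w - v * (vᴴ * B * w) with hw'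
    have h1 : w' * constDiagonal Unit p = w' := by
      rw [hw', Matrix.sub_mul, hw, Matrix.mul_assoc, Matrix.mul_assoc, hw]
    have h2 : vᴴ * B * w' = 0 := by
      rw [hw', Matrix.mul_sub, ← Matrix.mul_assoc, hvb, ← Matrix.mul_assoc, ← Matrix.mul_assoc, hPv,
        sub_self]
    have h3 : CStarMatrix.conj w' b = 0 := by
      by_contra h3
      obtain ⟨v', hv'⟩ := hp.exists_conj_eq_of_ne_zero hb
        (show CStarMatrix.conj v b = CStarMatrix.scalarDiag (Fin r) p from hvb) h1 h2 h3
      let e : Fin (r + 1) ≃ Fin r ⊕ Unit := Fintype.equivOfCardEq (by simp)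
      have : r + 1 ∈ S := by
        refine ⟨v'.submatrix id e, CStarMatrix.ext fun i j => ?_⟩
        refine (congrFun (congrFun hv' (e i)) (e j)).trans ?_
        change Matrix.diagonal _ _ _ = Matrix.diagonal _ _ _
        simp [Matrix.diagonal_apply]
      exact absurd (hmax _ this) (by omega)
    have h4 : CStarMatrix.ofMatrix.symm s * w' = 0 := by
      have h5 : (CStarMatrix.ofMatrix.symm s * w')ᴴ * (CStarMatrix.ofMatrix.symm s * w') = 0 := by
        rw [Matrix.conjTranspose_mul]
        have : w'ᴴ * B * w' = 0 := h3
        rw [hs'] at this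
        rw [← this]
        simp only [Matrix.mul_assoc]
      have h6 := congrFun (congrFun h5 ()) ()
      rw [Matrix.mul_apply] at h6
      ext i ⟨⟩
      have h7 := (Finset.sum_eq_zero_iff_of_nonneg fun k _ => star_mul_self_nonneg _).1
        h6 i (Finset.mem_univ _)
      exact (CStarRing.star_mul_self_eq_zero_iff _).1 h7
    have h5 : B * w' = 0 := by rw [hs', Matrix.mul_assoc, h4, Matrix.mul_zero]
    rw [hw', Matrix.mul_sub] at h5
    rw [Matrix.sub_mul, ← h5]
    simp only [Matrix.mul_assoc]
  have hE : B - B * v * (vᴴ * B) = 0 := by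
    ext i j
    by_contra h
    obtain ⟨z, hz⟩ := hA.exists_mul_mul_ne_zero h hp.ne_zero
    -- A column carrying `z p` in row `j` detects the entry `(i, j)`.
    have h1 := key (Matrix.of fun k _ => if k = j then z * p else 0) (by
      ext k ⟨⟩
      rw [Matrix.mul_diagonal]
      by_cases hk : k = j <;> simp [hk, mul_assoc, hp.mul_self])
    have h2 := congrFun (congrFun h1 i) ()
    rw [Matrix.mul_apply] at h2
    simp only [Matrix.of_apply, mul_ite, mul_zero, Finset.sum_ite_eq', Finset.mem_univ, if_true,
      ← mul_assoc] at h2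
    exact hz h2
  refine ⟨r, ?_, ?_⟩
  · have : b = CStarMatrix.conj (vᴴ * B) (CStarMatrix.scalarDiag (Fin r) p) := by
      have h1 : B = (vᴴ * B)ᴴ * constDiagonal (Fin r) p * (vᴴ * B) := by
        rw [Matrix.mul_assoc, ← Matrix.mul_assoc _ vᴴ, hPv, Matrix.conjTranspose_mul, hBs,
          Matrix.conjTranspose_conjTranspose]
        exact sub_eq_zero.1 hE
      exact h1
    conv_lhs => rw [this]
    exact CStarMatrix.CuntzLE.of_conj _ _
  · have : CStarMatrix.scalarDiag (Fin r) p = CStarMatrix.conj v₀ b := hv₀.symm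
    rw [this]
    exact CStarMatrix.CuntzLE.of_conj _ _

/-- The Cuntz semigroup of a simple unital C⋆-algebra with a minimal projection is almost
unperforated. -/
theorem almostUnperforated (hA : IsSimpleCStarAlgebra A) (hp : IsMinimalProjection p) :
    AlmostUnperforatedCuntzSemigroup A := by
  rw [almostUnperforated_iff]
  intro m n a b ha hb k hk hab
  have hpn : 0 ≤ p := by
    rw [← hp.mul_self]
    nth_rewrite 1 [← hp.isSelfAdjoint.star_eq]
    exact star_mul_self_nonneg _
  obtain ⟨r, har, hra⟩ := hp.exists_cuntzLE_scalarDiag hA ha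
  obtain ⟨s, hbs, hsb⟩ := hp.exists_cuntzLE_scalarDiag hA hb
  have hr := CStarMatrix.scalarDiag_nonneg (κ := Fin r) hpn
  have hs := CStarMatrix.scalarDiag_nonneg (κ := Fin s) hpn
  have h1 : CStarMatrix.cuntzClass a ha = CStarMatrix.cuntzClass _ hr :=
    le_antisymm (CStarMatrix.cuntzClass_le_iff.2 har) (CStarMatrix.cuntzClass_le_iff.2 hra)
  have h2 : CStarMatrix.cuntzClass b hb = CStarMatrix.cuntzClass _ hs :=
    le_antisymm (CStarMatrix.cuntzClass_le_iff.2 hbs) (CStarMatrix.cuntzClass_le_iff.2 hsb)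
  have h3 := CStarMatrix.nsmul_cuntzClass_le_iff (ha := ha) (hb := hb).2 hab
  rw [h1, h2, CStarMatrix.nsmul_cuntzClass_le_iff] at h3
  have h4 : ∀ t l : ℕ, CStarMatrix.amp (Fin l) (CStarMatrix.scalarDiag (Fin t) p) =
      CStarMatrix.scalarDiag (Fin t × Fin l) p := fun t l =>
    Matrix.blockDiagonal_diagonal fun (_ : Fin l) (_ : Fin t) => p
  rw [h4, h4] at h3
  have h5 := hp.card_le_of_cuntzLE h3
  simp only [Fintype.card_prod, Fintype.card_fin] at h5
  have h6 : r ≤ s := by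
    by_contra! h
    nlinarith
  refine har.trans (CStarMatrix.CuntzLE.trans ?_ hsb)
  have h7 : RectSubequiv ((constDiagonal (Fin s) p).submatrix (Fin.castLE h6) (Fin.castLE h6))
      (constDiagonal (Fin s) p) := RectSubequiv.submatrix_left
    (CStarMatrix.CuntzLE.refl (CStarMatrix.scalarDiag (Fin s) p)) (Fin.castLE h6)
  have h8 : (constDiagonal (Fin s) p).submatrix (Fin.castLE h6) (Fin.castLE h6) =
      constDiagonal (Fin r) p :=
    Matrix.submatrix_diagonal _ _ (Fin.castLE_injective h6)
  rw [h8] at h7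
  exact h7

end IsMinimalProjection

end MinimalProjectionRank

instance CuntzSemigroup.instIsOrderedAddMonoid {A : Type u} [NonUnitalCStarAlgebra A]
    [PartialOrder A] [StarOrderedRing A] : IsOrderedAddMonoid (CuntzSemigroup A) where
  add_le_add_left x y h z := by
    obtain ⟨a, rfl⟩ := CuntzSemigroup.mk_surjective x
    obtain ⟨b, rfl⟩ := CuntzSemigroup.mk_surjective y
    obtain ⟨c, rfl⟩ := CuntzSemigroup.mk_surjective z
    exact PosMatrix.add_le_add h le_rfl

/-! ### Orthogonal and small elements when there is no minimal projection. -/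

section OrthogonalElements

variable {D : Type u} [CStarAlgebra D] [PartialOrder D] [StarOrderedRing D]

/-- Replacing `T` by its real part changes neither `w T w` nor the bound. Together with the next
estimates, this lets an explicit factorization `w T w` certify subequivalence to `w`, without
positivity of `T`. -/
theorem mul_mul_self_le_norm_smul {w T : D} (hw : IsSelfAdjoint w) (h : IsSelfAdjoint (w * T * w)) :
    w * T * w ≤ ‖T‖ • (w * w) := by
  set H : D := (2⁻¹ : ℝ) • (T + star T) with hH
  have hHs : IsSelfAdjoint H := (IsSelfAdjoint.all _).smul (IsSelfAdjoint.add_star_self T)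
  have e : w * T * w = w * H * w := by
    have h1 : w * star T * w = w * T * w := by
      have := h.star_eq
      rwa [star_mul, star_mul, hw.star_eq, ← mul_assoc] at this
    rw [hH, mul_smul_comm, smul_mul_assoc, mul_add, add_mul, h1, ← two_smul ℝ, smul_smul]
    norm_num
  have hn : ‖H‖ ≤ ‖T‖ := by
    rw [hH, norm_smul]
    have := norm_add_le T (star T)
    rw [norm_star] at this
    norm_num
    linarith
  have h2 : H ≤ algebraMap ℝ D ‖T‖ :=
    (hHs.le_algebraMap_norm_self).trans (algebraMap_mono D hn)
  have h3 := hw.conjugate_le_conjugate h2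
  rw [e]
  refine h3.trans (le_of_eq ?_)
  rw [Algebra.algebraMap_eq_smul_one, mul_smul_comm, smul_mul_assoc, mul_one]

theorem mul_self_le_norm_smul {w : D} (hw : 0 ≤ w) : w * w ≤ ‖w‖ • w := by
  set s := CFC.sqrt w with hs
  have hss : IsSelfAdjoint s := .of_nonneg (CFC.sqrt_nonneg w)
  have hsw : s * s = w := CFC.sqrt_mul_sqrt_self w
  have h1 : w * w = s * w * s := by rw [← hsw]; simp only [mul_assoc]
  have h2 : IsSelfAdjoint (s * w * s) := by
    simpa [hss.star_eq] using (IsSelfAdjoint.of_nonneg hw).conjugate s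
  rw [h1]
  refine (mul_mul_self_le_norm_smul hss h2).trans (le_of_eq ?_)
  rw [hsw]

theorem mul_mul_le_norm_mul_norm_smul {w T : D} (hw : 0 ≤ w) (h : 0 ≤ w * T * w) :
    w * T * w ≤ (‖T‖ * ‖w‖) • w := by
  have h1 := mul_mul_self_le_norm_smul (.of_nonneg hw) (.of_nonneg h)
  have h2 := smul_le_smul_of_nonneg_left (mul_self_le_norm_smul hw) (norm_nonneg T)
  rw [smul_smul] at h2
  exact h1.trans h2

/-- Without minimal projections `c D c` has zero divisors `f g = 0`; the positive elements `f⋆ f`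
and `g g⋆` are then nonzero and orthogonal. -/
theorem exists_orthogonal (hD : ¬ ∃ p : D, IsMinimalProjection p) {c : D} (hc : 0 ≤ c)
    (hc0 : c ≠ 0) : ∃ y z : D, 0 ≤ c * y * c ∧ 0 ≤ c * z * c ∧ c * y * c ≠ 0 ∧ c * z * c ≠ 0 ∧
      c * y * c * (c * z * c) = 0 := by
  have hcs : IsSelfAdjoint c := .of_nonneg hc
  have := mt (exists_isMinimalProjection_of_noZeroDivisors hcs hc0) hD
  push Not at this
  obtain ⟨y, z, hyz, hy, hz⟩ := this
  have e1 : c * (star y * c * c * y) * c = star (c * y * c) * (c * y * c) := by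
    simp only [star_mul, hcs.star_eq, mul_assoc]
  have e2 : c * (z * c * c * star z) * c = (c * z * c) * star (c * z * c) := by
    simp only [star_mul, hcs.star_eq, mul_assoc]
  refine ⟨star y * c * c * y, z * c * c * star z, ?_⟩
  rw [e1, e2]
  refine ⟨star_mul_self_nonneg _, mul_star_self_nonneg _, ?_, ?_, ?_⟩
  · exact fun h => hy ((CStarRing.star_mul_self_eq_zero_iff _).1 h)
  · exact fun h => hz ((CStarRing.mul_star_self_eq_zero_iff _).1 h)
  · rw [mul_assoc, ← mul_assoc (c * y * c), hyz, zero_mul, mul_zero]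

end OrthogonalElements

namespace CStarMatrix

variable {A : Type u} [CStarAlgebra A] [PartialOrder A] [StarOrderedRing A] {q : ℕ}

theorem CuntzLE.of_mul_mul {n : Type*} [Fintype n] {w T : CStarMatrix n n A} (hw : 0 ≤ w)
    (h : 0 ≤ w * T * w) : CuntzLE (w * T * w) w := by
  classical
  exact CuntzLE.of_le_smul h (by positivity) (mul_mul_le_norm_mul_norm_smul hw h)

theorem zero_le_cuntzClass (a : CStarMatrix (Fin q) (Fin q) A) (ha : 0 ≤ a) :
    0 ≤ cuntzClass a ha :=
  (PosMatrix.le_iff_rectSubequiv 0 ⟨q, a, ha⟩).2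
    (subset_closure ⟨0, Matrix.ext fun i => Fin.elim0 i⟩)

/-- Induction over all `u` at once. Split off orthogonal `c₁`, `c₂` under `u` and find `d'`, `e'`
under `c₂` with `n⟨d'⟩ ≤ ⟨e'⟩`. Primeness gives `c₁ t d' ≠ 0`, whose square `d` lies below both `d'`
and `c₁`, so `(n+1)⟨d⟩ ≤ ⟨e'⟩ + ⟨c₁⟩ = ⟨e' + c₁⟩`. -/
theorem exists_nsmul_le (hA : IsSimpleCStarAlgebra A)
    (hD : ¬ ∃ p : CStarMatrix (Fin q) (Fin q) A, IsMinimalProjection p) (n : ℕ) :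
    ∀ u : CStarMatrix (Fin q) (Fin q) A, 0 ≤ u → u ≠ 0 →
      ∃ (y z : CStarMatrix (Fin q) (Fin q) A) (hy : 0 ≤ u * y * u) (hz : 0 ≤ u * z * u),
        u * y * u ≠ 0 ∧ u * y * u * (u * z * u) = 0 ∧
        n • cuntzClass (u * y * u) hy ≤ cuntzClass (u * z * u) hz := by
  induction n with
  | zero =>
    intro u hu hu0
    have h1 : u * 1 * u = star u * u := by rw [mul_one, (IsSelfAdjoint.of_nonneg hu).star_eq]
    refine ⟨1, 0, ?_, ?_, ?_, ?_, ?_⟩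
    · rw [h1]
      exact star_mul_self_nonneg _
    · simp
    · rw [h1]
      exact fun h => hu0 ((CStarRing.star_mul_self_eq_zero_iff _).1 h)
    · simp
    · rw [zero_nsmul]
      exact zero_le_cuntzClass _ _
  | succ n ih =>
    intro u hu hu0
    obtain ⟨y₁, y₂, hc₁, hc₂, hc₁0, hc₂0, hc₁₂⟩ := exists_orthogonal hD hu hu0
    obtain ⟨y, z, hd', he', hd'0, hde', hle⟩ := ih _ hc₂ hc₂0
    set c₁ := u * y₁ * u with hc₁d
    set c₂ := u * y₂ * u with hc₂d
    set d' := c₂ * y * c₂ with hd'd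
    set e' := c₂ * z * c₂ with he'd
    have sc₁ : star c₁ = c₁ := (IsSelfAdjoint.of_nonneg hc₁).star_eq
    have sc₂ : star c₂ = c₂ := (IsSelfAdjoint.of_nonneg hc₂).star_eq
    have sd' : star d' = d' := (IsSelfAdjoint.of_nonneg hd').star_eq
    have hc₂₁ : c₂ * c₁ = 0 := by
      have := congrArg star hc₁₂
      rwa [star_mul, sc₁, sc₂, star_zero] at this
    have hd'c : d' * c₁ = 0 := by rw [hd'd, mul_assoc, hc₂₁, mul_zero]
    have he'c : e' * c₁ = 0 := by rw [he'd, mul_assoc, hc₂₁, mul_zero]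
    obtain ⟨t, ht⟩ := exists_mul_mul_ne_zero hA hc₁0 hd'0
    have e1 : star (c₁ * t * d') * (c₁ * t * d') = d' * (star t * c₁ * c₁ * t) * d' := by
      simp only [star_mul, sc₁, sd', mul_assoc]
    have e2 : star (c₁ * t * d') * (c₁ * t * d') =
        u * (y₂ * u * y * c₂ * (star t * c₁ * c₁ * t) * c₂ * y * u * y₂) * u := by
      rw [e1, hd'd]
      nth_rewrite 1 [hc₂d]
      nth_rewrite 3 [hc₂d]
      simp only [mul_assoc]
    have e3 : c₁ + e' = u * (y₁ + y₂ * u * z * u * y₂) * u := by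
      rw [hc₁d, he'd, hc₂d, mul_add, add_mul]
      simp only [mul_assoc]
    have hdn : 0 ≤ star (c₁ * t * d') * (c₁ * t * d') := star_mul_self_nonneg _
    have hen : 0 ≤ c₁ + e' := add_nonneg hc₁ he'
    have hd0 : star (c₁ * t * d') * (c₁ * t * d') ≠ 0 :=
      fun h => ht ((CStarRing.star_mul_self_eq_zero_iff _).1 h)
    have hde : star (c₁ * t * d') * (c₁ * t * d') * (c₁ + e') = 0 := by
      rw [mul_assoc, mul_assoc _ d', mul_add, hd'c, hde', add_zero, mul_zero, mul_zero]
    have hd1 : CuntzLE (star (c₁ * t * d') * (c₁ * t * d')) d' := by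
      rw [e1]
      exact CuntzLE.of_mul_mul hd' (e1 ▸ hdn)
    have hd2 : CuntzLE (star (c₁ * t * d') * (c₁ * t * d')) c₁ := by
      have e4 : star (c₁ * t * d') * (c₁ * t * d') =
          conj (ofMatrix.symm (t * d')) (c₁ * 1 * c₁) := by
        rw [conj_ofMatrix_symm]
        simp only [star_mul, sc₁, sd', mul_assoc, one_mul]
      rw [e4]
      refine (CuntzLE.of_conj _ _).trans (CuntzLE.of_mul_mul hc₁ ?_)
      rw [mul_one]
      nth_rewrite 1 [← sc₁]
      exact star_mul_self_nonneg _
    have hle' : (n + 1) • cuntzClass _ hdn ≤ cuntzClass _ hen := by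
      have l1 : cuntzClass _ hdn ≤ cuntzClass d' hd' := cuntzClass_le_iff.2 hd1
      have l2 : cuntzClass _ hdn ≤ cuntzClass c₁ hc₁ := cuntzClass_le_iff.2 hd2
      have l3 : cuntzClass e' he' + cuntzClass c₁ hc₁ ≤ cuntzClass _ hen := by
        rw [cuntzClass_add_le_iff]
        have := CuntzLE.dirSum_add he' hc₁ he'c
        rwa [add_comm e'] at this
      rw [succ_nsmul]
      exact (add_le_add ((nsmul_le_nsmul_right l1 n).trans hle) l2).trans l3
    -- The witnesses must appear in the form `u * _ * u`, so all facts are rewritten before being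
    -- supplied.
    revert hdn hen
    rw [e2] at hd0 hde ⊢
    rw [e3] at hde ⊢
    exact fun hdn hen hle' => ⟨_, _, hdn, hen, hd0, hde, hle'⟩

end CStarMatrix

/-! ### Local units, and making room below a positive matrix. -/

section LocalUnit

variable {D : Type u} [CStarAlgebra D] [PartialOrder D] [StarOrderedRing D]

theorem exists_nonneg_mul_self_eq {b : D} (hb : 0 ≤ b) : ∃ u : D, 0 ≤ u ∧ u * u = b :=
  ⟨CFC.sqrt b, CFC.sqrt_nonneg b, CFC.sqrt_mul_sqrt_self b⟩

/-- A nonzero positive element `d` has a nonzero cut-down with a local unit of the form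
`d k d`. -/
theorem exists_localUnit {d : D} (hd : 0 ≤ d) (hd0 : d ≠ 0) :
    ∃ k c : D, IsSelfAdjoint (d * k * d) ∧ 0 ≤ d * k * d ∧ 0 ≤ c ∧ c ≠ 0 ∧
      d * k * d * c = c ∧ c * (d * k * d) = c := by
  have hds : IsSelfAdjoint d := .of_nonneg hd
  have hn : 0 < ‖d‖ := norm_pos_iff.2 hd0
  -- Any level strictly between `0` and `‖d‖` keeps the cut-down nonzero; `d k d` is `1` on the part
  -- of the spectrum above it.
  set s : ℝ := ‖d‖ / 2 with hs
  have hs0 : 0 < s := by positivity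
  have hg := max_inv_continuous hs0
  set k := cfc (fun t : ℝ => (max t s)⁻¹ * (max t s)⁻¹) d with hk
  have hk0 : 0 ≤ k := cfc_nonneg fun t _ => mul_self_nonneg _
  have hks : IsSelfAdjoint k := .of_nonneg hk0
  have hf0 : 0 ≤ d * k * d := hds.conjugate_nonneg hk0
  have hfs : IsSelfAdjoint (d * k * d) := .of_nonneg hf0
  have hcn := cutDown_nonneg d s
  have hcs : IsSelfAdjoint (cutDown d s) := .of_nonneg hcn
  have hfc : d * k * d * cutDown d s = cutDown d s := by
    have e : d * k * d = cfc (fun t : ℝ => t * ((max t s)⁻¹ * (max t s)⁻¹) * t) d := by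
      rw [cfc_mul (fun t : ℝ => t * ((max t s)⁻¹ * (max t s)⁻¹)) (fun t => t) d
          (continuous_id.mul (hg.mul hg)).continuousOn continuousOn_id,
        cfc_mul (fun t : ℝ => t) (fun t => (max t s)⁻¹ * (max t s)⁻¹) d continuousOn_id
          (hg.mul hg).continuousOn, cfc_id' ℝ d]
    rw [e, cutDown, ← cfc_mul (fun t : ℝ => t * ((max t s)⁻¹ * (max t s)⁻¹) * t) _ d
      ((continuous_id.mul (hg.mul hg)).mul continuous_id).continuousOn (by fun_prop)]
    refine cfc_congr fun t _ => ?_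
    rcases le_total t s with h | h
    · have : max (t - s) 0 = 0 := max_eq_right (by linarith)
      simp [this]
    · have : t ≠ 0 := (hs0.trans_le h).ne'
      have e : t * ((max t s)⁻¹ * (max t s)⁻¹) * t = 1 := by
        rw [max_eq_left h]
        field_simp
      simp only [e, one_mul]
  refine ⟨k, cutDown d s, hfs, hf0, hcn, ?_, hfc, ?_⟩
  · intro h
    have := norm_sub_cutDown_le hd hs0.le
    rw [h, sub_zero] at this
    linarith
  · have := congrArg star hfc
    rwa [star_mul, hcs.star_eq, hfs.star_eq] at this

end LocalUnit

namespace CStarMatrix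

variable {A : Type u} [CStarAlgebra A] [PartialOrder A] [StarOrderedRing A] {q : ℕ}

/-- If `M_q(A)` has no minimal projection, then a nonzero positive `b` dominates an orthogonal sum
of a nonzero element and an element which is, up to almost unperforation, as large as `b`. -/
theorem exists_room (hA : IsSimpleCStarAlgebra A)
    (hD : ¬ ∃ p : CStarMatrix (Fin q) (Fin q) A, IsMinimalProjection p) (n : ℕ)
    {b : CStarMatrix (Fin q) (Fin q) A} (hb : 0 ≤ b) (hb0 : b ≠ 0) :
    ∃ (b₁ c : CStarMatrix (Fin q) (Fin q) A) (hb₁ : 0 ≤ b₁) (hc : 0 ≤ c), c ≠ 0 ∧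
      cuntzClass b₁ hb₁ + cuntzClass c hc ≤ cuntzClass b hb ∧
      n • cuntzClass b hb ≤ (n + 1) • cuntzClass b₁ hb₁ := by
  obtain ⟨u, hun, huu⟩ := exists_nonneg_mul_self_eq hb
  have hus : IsSelfAdjoint u := .of_nonneg hun
  have hbs : IsSelfAdjoint b := .of_nonneg hb
  have hu0 : u ≠ 0 := by
    intro h
    rw [h, mul_zero] at huu
    exact hb0 huu.symm
  obtain ⟨y, z, hd, he, hd0, hde, hle⟩ := exists_nsmul_le hA hD n u hun hu0
  set d := u * y * u with hdd
  set e := u * z * u with hed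
  obtain ⟨k, c, hfs, hf0, hc, hc0, hfc, hcf⟩ := exists_localUnit hd hd0
  set f := d * k * d with hfd
  have hxs : IsSelfAdjoint (1 - f) := (IsSelfAdjoint.one _).sub hfs
  -- Since `f` acts as a unit on `c`, removing `f` from `b` leaves an element orthogonal to `c`.
  have hb₁ : 0 ≤ (1 - f) * b * (1 - f) := hxs.conjugate_nonneg hb
  have hfe : f * e = 0 := by rw [hfd, mul_assoc, hde, mul_zero]
  have hef : e * f = 0 := by
    have := congrArg star hfe
    rwa [star_mul, hfs.star_eq, (IsSelfAdjoint.of_nonneg he).star_eq, star_zero] at this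
  refine ⟨_, c, hb₁, hc, hc0, ?_, ?_⟩
  · rw [cuntzClass_add_le_iff]
    have horth : (1 - f) * b * (1 - f) * c = 0 := by
      rw [mul_assoc, sub_mul 1 f c, hfc, one_mul, sub_self, mul_zero]
    refine (CuntzLE.dirSum_add hb₁ hc horth).trans ?_
    set w := y * u * k * u * y with hw
    have hfw : f = u * w * u := by
      rw [hfd, hdd, hw]
      simp only [mul_assoc]
    have hcw : c = u * (w * u * c * u * w) * u := by
      calc c = f * c * f := by rw [hfc, hcf]
        _ = _ := by
          rw [hfw]
          simp only [mul_assoc]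
    -- Both summands factor through `u = √b`, so the sum is dominated by a multiple of `u² = b`.
    have hT : (1 - f) * b * (1 - f) + c =
        u * (1 - w * b - b * w + w * b * b * w + w * u * c * u * w) * u := by
      conv_lhs => rw [hcw, hfw]
      rw [← huu]
      noncomm_ring
    have hn : 0 ≤ (1 - f) * b * (1 - f) + c := add_nonneg hb₁ hc
    rw [hT] at hn ⊢
    have h1 := mul_mul_self_le_norm_smul hus (.of_nonneg hn)
    rw [huu] at h1
    exact CuntzLE.of_le_smul hn (norm_nonneg _) h1
  · have l1 : cuntzClass b hb ≤ cuntzClass _ hb₁ + cuntzClass d hd := by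
      rw [cuntzClass_le_add_iff]
      have hfbf : 0 ≤ f * b * f := hfs.conjugate_nonneg hb
      have e1 : f * b * f = d * (k * d * b * d * k) * d := by
        rw [hfd]
        simp only [mul_assoc]
      have h1 : CuntzLE (f * b * f) d := by
        rw [e1]
        exact CuntzLE.of_mul_mul hd (e1 ▸ hfbf)
      -- The difference of the two sides is `(1 - 2f) b (1 - 2f)`.
      have h2 : b ≤ (2 : ℝ) • ((1 - f) * b * (1 - f) + f * b * f) := by
        have h3 : IsSelfAdjoint (1 - f - f) := hxs.sub hfs
        have h4 := h3.conjugate_nonneg hb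
        rw [← sub_nonneg]
        convert h4 using 1
        rw [two_smul]
        noncomm_ring
      exact ((CuntzLE.of_le_smul hb zero_le_two h2).trans (CuntzLE.add_dirSum _ _)).trans
        (CuntzLE.dirSum_le_dirSum (CuntzLE.refl _) h1)
    -- As `e` is orthogonal to `f`, compressing `e ≤ r b` by `1 - f` leaves `e` unchanged.
    have l2 : cuntzClass e he ≤ cuntzClass _ hb₁ := by
      rw [cuntzClass_le_iff]
      have e1 : (1 - f) * e * (1 - f) = e := by
        rw [sub_mul 1 f e, hfe, one_mul, sub_zero, mul_sub, hef, mul_one, sub_zero]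
      have h1 := mul_mul_self_le_norm_smul hus (.of_nonneg he)
      rw [huu] at h1
      have h2 := hxs.conjugate_le_conjugate h1
      rw [mul_smul_comm, smul_mul_assoc] at h2
      change (1 - f) * e * (1 - f) ≤ _ at h2
      rw [e1] at h2
      exact CuntzLE.of_le_smul he (norm_nonneg _) h2
    calc n • cuntzClass b hb ≤ n • (cuntzClass _ hb₁ + cuntzClass d hd) :=
          nsmul_le_nsmul_right l1 n
      _ = n • cuntzClass _ hb₁ + n • cuntzClass d hd := nsmul_add _ _ _
      _ ≤ n • cuntzClass _ hb₁ + cuntzClass _ hb₁ := by gcongr; exact hle.trans l2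
      _ = _ := (succ_nsmul _ _).symm

/-- In a simple unital C⋆-algebra `A` such that `M_q(A)` has no minimal projection, arbitrarily
many copies of some nonzero element of `A` fit below a given nonzero positive matrix. -/
theorem exists_scalarDiag_le (hA : IsSimpleCStarAlgebra A)
    (hD : ¬ ∃ p : CStarMatrix (Fin q) (Fin q) A, IsMinimalProjection p) (n : ℕ)
    {c : CStarMatrix (Fin q) (Fin q) A} (hc : 0 ≤ c) (hc0 : c ≠ 0) :
    ∃ d : A, 0 ≤ d ∧ d ≠ 0 ∧ CuntzLE (scalarDiag (Fin n) d) c := by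
  obtain ⟨y, z, hd, he, hd0, -, hle⟩ := exists_nsmul_le hA hD n c hc hc0
  rw [nsmul_cuntzClass_le_cuntzClass_iff] at hle
  obtain ⟨s, hs⟩ := exists_eq_star_mul_self hd
  set D := c * y * c with hDd
  have hent : ∀ i, D i i = ∑ k, star (s k i) * s k i := by
    intro i
    rw [hs]
    rfl
  obtain ⟨i, hi⟩ : ∃ i, D i i ≠ 0 := by
    by_contra! h
    apply hd0
    have hs0 : s = 0 := by
      ext j i
      have h1 := hent i
      rw [h i] at h1
      have h2 := (Finset.sum_eq_zero_iff_of_nonneg fun k _ => star_mul_self_nonneg (s k i)).1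
        h1.symm j (Finset.mem_univ _)
      exact (CStarRing.star_mul_self_eq_zero_iff _).1 h2
    rw [hs, hs0, mul_zero]
  refine ⟨D i i, ?_, hi, ?_⟩
  · rw [hent]
    exact Finset.sum_nonneg fun k _ => star_mul_self_nonneg _
  · refine CuntzLE.trans ?_ (hle.trans (CuntzLE.of_mul_mul hc he))
    -- Selecting index `i` in each of the `n` blocks leaves the diagonal matrix of copies of `D i
    -- i`.
    have h1 : RectSubequiv ((Matrix.blockDiagonal fun _ : Fin n => ofMatrix.symm D).submatrix
        (fun j => (i, j)) (fun j => (i, j))) (ofMatrix.symm (amp (Fin n) D)) :=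
      RectSubequiv.submatrix_left (CuntzLE.refl (amp (Fin n) D)) (fun j => (i, j))
    have h2 : (Matrix.blockDiagonal fun _ : Fin n => ofMatrix.symm D).submatrix
        (fun j => (i, j)) (fun j => (i, j)) = Matrix.diagonal fun _ => D i i := by
      ext j l
      rw [Matrix.submatrix_apply, Matrix.blockDiagonal_apply, Matrix.diagonal_apply]
      rfl
    rw [h2] at h1
    exact h1

end CStarMatrix

/-! ### Unit elements, and cancelling the multiplicity in the approximating algebra. -/

section Unital

/-- A non-unital C⋆-algebra with a unit element is a unital C⋆-algebra. -/
theorem exists_cstarAlgebra_of_unit {B : Type v} [inst : NonUnitalCStarAlgebra B] (e : B)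
    (he : ∀ x : B, e * x = x ∧ x * e = x) :
    ∃ i : CStarAlgebra B, @CStarAlgebra.toNonUnitalCStarAlgebra B i = inst := by
  let r : Ring B :=
    { (inferInstance : NonUnitalRing B) with
      one := e
      one_mul := fun x => (he x).1
      mul_one := fun x => (he x).2 }
  let nr : NormedRing B :=
    { r, (inferInstance : NonUnitalNormedRing B) with }
  let na : NormedAlgebra ℂ B :=
    { Algebra.ofModule (R := ℂ) (A := B) smul_mul_assoc mul_smul_comm with
      norm_smul_le := norm_smul_le }
  exact ⟨{ nr, na, inst with }, rfl⟩

end Unital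

namespace CStarMatrix
variable {B : Type u} [CStarAlgebra B] [PartialOrder B] [StarOrderedRing B]

variable {p q K : ℕ}

/-- With `C = (a - ε)₊` and `g = (t - η)₊`, the hypothesis gives `(K+1)⟨C³⟩ ≤ K⟨g⟩`, hence `C ≲ g³`.
As `g³ = g (t - η) g`, the answer is a compression of `t - η`. One `ε` pays for cutting down `a`,
the other for approximating `C`. -/
theorem exists_le_conj_of_almostUnperforated (hB : AlmostUnperforatedCuntzSemigroup B)
    {a : CStarMatrix (Fin p) (Fin p) B} (ha : 0 ≤ a) {t : CStarMatrix (Fin q) (Fin q) B}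
    (ht : IsSelfAdjoint t) {η ε : ℝ} (hε : 0 < ε) (hK : 1 ≤ K)
    {X : Matrix (Fin q × Fin K) (Fin p × Fin (K + 1)) B}
    (h : amp (Fin (K + 1)) a ≤ conj X (amp (Fin K) (cutDown t η)) + realScalar _ ε) :
    ∃ w : Matrix (Fin q) (Fin p) B,
      a ≤ conj w (t - realScalar _ η) + realScalar _ (2 * ε) := by
  have has : IsSelfAdjoint a := .of_nonneg ha
  set C := cutDown a ε with hC
  set g := cutDown t η with hg
  have hCn : 0 ≤ C := cutDown_nonneg a ε
  have hCs : IsSelfAdjoint C := .of_nonneg hCn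
  have hgn : 0 ≤ g := cutDown_nonneg t η
  have hgs : IsSelfAdjoint g := .of_nonneg hgn
  have h1 : amp (Fin (K + 1)) (C * C * C) ≤
      conj (X * ofMatrix.symm (amp (Fin (K + 1)) C)) (amp (Fin K) g) := by
    rw [← cutDown_mul_sub_mul_cutDown has, ← hC, amp_mul, amp_mul, amp_sub, amp_realScalar,
      ← conj_conj, conj_ofMatrix_symm, ← amp_star, hCs.star_eq]
    have hs : IsSelfAdjoint (amp (Fin (K + 1)) C) := by
      rw [IsSelfAdjoint, ← amp_star, hCs.star_eq]
    exact hs.conjugate_le_conjugate (sub_le_iff_le_add.2 h)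
  have hCCC : 0 ≤ C * C * C := hCs.conjugate_nonneg hCn
  have h2 : CuntzLE (amp (Fin (K + 1)) (C * C * C)) (amp (Fin K) g) :=
    (CuntzLE.of_le (amp_nonneg hCCC) h1).trans (CuntzLE.of_conj _ _)
  have h3 := almostUnperforated_iff.1 hB p q _ _ hCCC hgn K hK h2
  have h4 : CuntzLE C (g * g * g) := ((CuntzLE.cube hCn).trans h3).trans (CuntzLE.cube hgn)
  obtain ⟨y, hy⟩ := cuntzLE_iff.1 h4 ε hε
  have h5 : conj y (g * g * g) = conj (ofMatrix.symm g * y) (t - realScalar _ η) := by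
    rw [← cutDown_mul_sub_mul_cutDown ht, ← hg, ← conj_conj, conj_ofMatrix_symm, hgs.star_eq]
  have h6 : 0 ≤ conj y (g * g * g) := conj_nonneg y (hgs.conjugate_nonneg hgn)
  refine ⟨ofMatrix.symm g * y, ?_⟩
  rw [← h5]
  have h7 := le_add_realScalar_of_norm_sub_le (hCs.sub (.of_nonneg h6)) hy.le
  have h8 := le_cutDown_add has ε
  rw [sub_le_iff_le_add] at h8
  calc a ≤ C + realScalar _ ε := h8
    _ ≤ conj y (g * g * g) + realScalar _ ε + realScalar _ ε := by gcongr
    _ = _ := by rw [two_mul, realScalar_add, add_assoc]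

end CStarMatrix

/-! ### Completely positive maps applied entrywise to matrices. -/

section CompletelyPositive

set_option linter.unusedSectionVars false

variable {A : Type u} {B : Type v} [CStarAlgebra A] [PartialOrder A] [StarOrderedRing A]
  [CStarAlgebra B] [PartialOrder B] [StarOrderedRing B]
variable {l m n κ : Type*} [Fintype l] [Fintype m] [Fintype n] [Fintype κ]

theorem norm_realScalar_le {r : ℝ} (hr : 0 ≤ r) : ‖realScalar A r‖ ≤ r := by
  rw [realScalar, norm_algebraMap, Real.norm_of_nonneg hr]
  cases subsingleton_or_nontrivial A
  · rw [Subsingleton.elim (1 : A) 0, norm_zero, mul_zero]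
    exact hr
  · rw [CStarRing.norm_one, mul_one]

theorem realScalar_nonneg {r : ℝ} (hr : 0 ≤ r) : 0 ≤ realScalar A r := by
  have : realScalar A 0 = 0 := map_zero _
  rw [← this]
  exact realScalar_mono hr

namespace CompletelyPositiveMap

open CStarMatrix

variable (φ : A →CP B)

theorem map_sub_map (M N : CStarMatrix n n A) : (M - N).map φ = M.map φ - N.map φ :=
  ext fun _ _ => map_sub φ _ _

theorem map_add_map (M N : CStarMatrix n n A) : (M + N).map φ = M.map φ + N.map φ :=
  ext fun _ _ => map_add φ _ _

theorem map_real_smul_map (r : ℝ) (M : CStarMatrix n n A) : (r • M).map φ = r • M.map φ := by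
  refine ext fun i j => ?_
  change φ (r • M i j) = r • φ (M i j)
  rw [← Complex.coe_smul, map_smul, Complex.coe_smul]

theorem map_le_map {M N : CStarMatrix n n A} (h : M ≤ N) : M.map φ ≤ N.map φ := by
  rw [← sub_nonneg, ← map_sub_map]
  exact φ.map_cstarMatrix_nonneg _ (sub_nonneg.2 h)

theorem map_amp [DecidableEq κ] (M : CStarMatrix n n A) : (amp κ M).map φ = amp κ (M.map φ) := by
  refine ext fun i j => ?_
  rw [map_apply, amp_apply, amp_apply]
  split_ifs
  · rfl
  · exact map_zero φ

theorem map_conjTranspose (X : Matrix n m A) : (X.map φ)ᴴ = Xᴴ.map φ :=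
  Matrix.ext fun _ _ => (map_star φ _).symm

variable {φ}

/-- The maps need not be unital; contractivity still controls the image of a scalar from above. -/
theorem IsContractive.map_realScalar_le [DecidableEq n] (hφ : φ.IsContractive) {r : ℝ}
    (hr : 0 ≤ r) :
    (realScalar (CStarMatrix n n A) r).map φ ≤ realScalar (CStarMatrix n n B) r := by
  have h1 : φ (realScalar A r) ≤ realScalar B r := by
    have h2 : 0 ≤ φ (realScalar A r) := map_nonneg φ (realScalar_nonneg hr)
    exact le_realScalar_of_norm_le (.of_nonneg h2) ((hφ _).trans (norm_realScalar_le hr))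
  rw [← sub_nonneg]
  convert scalarDiag_nonneg (κ := n) (sub_nonneg.2 h1) using 1
  rw [realScalar_eq_diagonal, realScalar_eq_diagonal]
  refine ext fun i j => ?_
  change Matrix.diagonal (fun _ => realScalar B r) i j -
    φ (Matrix.diagonal (fun _ => realScalar A r) i j) =
    Matrix.diagonal (fun _ => realScalar B r - φ (realScalar A r)) i j
  rw [Matrix.diagonal_apply, Matrix.diagonal_apply, Matrix.diagonal_apply]
  split_ifs <;> simp

theorem norm_map_mul_sub_le {M : Matrix l n A} {N : Matrix n m A} {δ : ℝ}
    (h : ∀ i j k, ‖φ (M i j * N j k) - φ (M i j) * φ (N j k)‖ ≤ δ) (i : l) (k : m) :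
    ‖φ ((M * N) i k) - (M.map φ * N.map φ) i k‖ ≤ Fintype.card n * δ := by
  have e : φ ((M * N) i k) - (M.map φ * N.map φ) i k =
      ∑ j, (φ (M i j * N j k) - φ (M i j) * φ (N j k)) := by
    rw [Finset.sum_sub_distrib, ← map_sum]
    rfl
  rw [e]
  refine (norm_sum_le _ _).trans ((Finset.sum_le_sum fun j _ => h i j k).trans ?_)
  simp

theorem norm_map_gram_sub_le {X : Matrix n m A} {δ : ℝ}
    (h : ∀ i j k, ‖φ (star (X j i) * X j k) - φ (star (X j i)) * φ (X j k)‖ ≤ δ) :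
    ‖(gram X).map φ - gram (X.map φ)‖ ≤
      Fintype.card m * (Fintype.card m * (Fintype.card n * δ)) := by
  refine norm_le_card_mul fun i k => ?_
  have := norm_map_mul_sub_le (φ := φ) (M := Xᴴ) (N := X) h i k
  rw [← map_conjTranspose] at this
  exact this

/-- Multiplicativity is used twice: to split off `X⋆` from `b X`, then to split `b X`. The second
error is multiplied by the entries of `φ(X⋆)`, whence the factor `C`. -/
theorem norm_map_conj_sub_le (hφ : φ.IsContractive) {X : Matrix n m A} {b : CStarMatrix n n A}
    {δ C : ℝ} (hC : ∀ i j, ‖X i j‖ ≤ C) (hC0 : 0 ≤ C)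
    (h₁ : ∀ i j k, ‖φ (star (X j i) * (ofMatrix.symm b * X) j k) -
      φ (star (X j i)) * φ ((ofMatrix.symm b * X) j k)‖ ≤ δ)
    (h₂ : ∀ i j k, ‖φ (b i j * X j k) - φ (b i j) * φ (X j k)‖ ≤ δ) :
    ‖(conj X b).map φ - conj (X.map φ) (b.map φ)‖ ≤ Fintype.card m * (Fintype.card m *
      (Fintype.card n * δ + Fintype.card n * (C * (Fintype.card n * δ)))) := by
  refine norm_le_card_mul fun i k => ?_
  have h3 := norm_map_mul_sub_le (φ := φ) (M := Xᴴ) (N := ofMatrix.symm b * X) h₁ i k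
  have h4 : ∀ j, ‖((ofMatrix.symm b * X).map φ - (ofMatrix.symm b).map φ * X.map φ) j k‖ ≤
      Fintype.card n * δ := fun j =>
    norm_map_mul_sub_le (φ := φ) (M := ofMatrix.symm b) (N := X) h₂ j k
  have e : ((conj X b).map φ - conj (X.map φ) (b.map φ)) i k =
      (φ ((Xᴴ * (ofMatrix.symm b * X)) i k) - (Xᴴ.map φ * (ofMatrix.symm b * X).map φ) i k) +
      ∑ j, φ (star (X j i)) *
        ((ofMatrix.symm b * X).map φ - (ofMatrix.symm b).map φ * X.map φ) j k := by
    have e1 : (conj X b).map φ i k = φ ((Xᴴ * (ofMatrix.symm b * X)) i k) := by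
      rw [← Matrix.mul_assoc]
      rfl
    have e2 : conj (X.map φ) (b.map φ) i k =
        (Xᴴ.map φ * ((ofMatrix.symm b).map φ * X.map φ)) i k := by
      rw [← Matrix.mul_assoc, ← map_conjTranspose]
      rfl
    have e3 : ∑ j, φ (star (X j i)) *
        ((ofMatrix.symm b * X).map φ - (ofMatrix.symm b).map φ * X.map φ) j k =
        (Xᴴ.map φ * ((ofMatrix.symm b * X).map φ - (ofMatrix.symm b).map φ * X.map φ)) i k := rfl
    rw [CStarMatrix.sub_apply, e1, e2, e3, Matrix.mul_sub, Matrix.sub_apply]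
    abel
  rw [e]
  refine (norm_add_le _ _).trans (add_le_add h3 ((norm_sum_le _ _).trans ?_))
  refine (Finset.sum_le_sum (g := fun _ => C * (Fintype.card n * δ)) fun j _ => ?_).trans ?_
  · refine (norm_mul_le _ _).trans (mul_le_mul ((hφ _).trans ?_) (h4 j) (norm_nonneg _) hC0)
    rw [norm_star]
    exact hC j i
  · simp

theorem norm_gram_map_le (hφ : φ.IsContractive) {X : Matrix n m A} {C : ℝ}
    (hC : ∀ i j, ‖X i j‖ ≤ C) (hC0 : 0 ≤ C) :
    ‖gram (X.map φ)‖ ≤ Fintype.card m * (Fintype.card m * (Fintype.card n * (C * C))) := by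
  refine norm_le_card_mul fun i k => ?_
  have e : gram (X.map φ) i k = ∑ j, star (φ (X j i)) * φ (X j k) := rfl
  rw [e]
  refine (norm_sum_le _ _).trans
    ((Finset.sum_le_sum (g := fun _ => C * C) fun j _ => ?_).trans ?_)
  · refine (norm_mul_le _ _).trans (mul_le_mul ?_ ((hφ _).trans (hC j k)) (norm_nonneg _) hC0)
    rw [norm_star]
    exact (hφ _).trans (hC j i)
  · simp

end CompletelyPositiveMap

end CompletelyPositive

theorem norm_smul_le_of_nonneg {D : Type*} [CStarAlgebra D] {r : ℝ} (hr : 0 ≤ r) (x : D) :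
    ‖r • x‖ ≤ r * ‖x‖ := by
  rw [norm_smul, Real.norm_of_nonneg hr]

/-! ### Transporting approximate subequivalences through almost multiplicative maps. -/

section Approximation

set_option linter.unusedSectionVars false

variable {A : Type u} {B : Type v} [CStarAlgebra A] [PartialOrder A] [StarOrderedRing A]
  [CStarAlgebra B] [PartialOrder B] [StarOrderedRing B]
variable {m n κ : Type*} [Fintype m] [Fintype n] [Fintype κ]

theorem Matrix.exists_norm_le {A : Type*} [SeminormedAddCommGroup A] (X : Matrix n m A) :
    ∃ C : ℝ, 0 ≤ C ∧ ∀ i j, ‖X i j‖ ≤ C :=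
  ⟨∑ i, ∑ j, ‖X i j‖, by positivity, fun i j =>
    (Finset.single_le_sum (f := fun j => ‖X i j‖) (fun _ _ => norm_nonneg _)
      (Finset.mem_univ j)).trans
    (Finset.single_le_sum (f := fun i => ∑ j, ‖X i j‖) (fun _ _ => by positivity)
      (Finset.mem_univ i))⟩

namespace CStarMatrix

theorem isSelfAdjoint_conj (X : Matrix n m A) {b : CStarMatrix n n A} (hb : IsSelfAdjoint b) :
    IsSelfAdjoint (conj X b) := by
  change (Xᴴ * ofMatrix.symm b * X)ᴴ = Xᴴ * ofMatrix.symm b * X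
  have : (ofMatrix.symm b)ᴴ = ofMatrix.symm b := hb
  rw [Matrix.conjTranspose_mul, Matrix.conjTranspose_mul, Matrix.conjTranspose_conjTranspose, this,
    Matrix.mul_assoc]

theorem isSelfAdjoint_map (φ : A →CP B) {b : CStarMatrix n n A} (hb : IsSelfAdjoint b) :
    IsSelfAdjoint (b.map φ) := by
  refine ext fun i j => ?_
  change star (φ (b j i)) = φ (b i j)
  rw [← map_star]
  exact congrArg φ (congrFun (congrFun hb i) j)

theorem smul_gram_le [DecidableEq m] (X : Matrix n m A) {η ε : ℝ} (hη : 0 ≤ η)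
    (h : η * ‖gram X‖ ≤ ε) : η • gram X ≤ realScalar _ ε := by
  refine le_realScalar_of_norm_le ?_ ?_
  · exact (IsSelfAdjoint.all η).smul (.of_nonneg (gram_nonneg X))
  · exact (norm_smul_le_of_nonneg hη _).trans h

end CStarMatrix

namespace CompletelyPositiveMap

open CStarMatrix

/-- An almost multiplicative contractive completely positive map preserves a subequivalence
`a ⊗ 1 ≤ X⋆ (b ⊗ 1) X + ε`, up to cutting down `b`. -/
theorem IsContractive.amp_map_le [DecidableEq m] [DecidableEq n] [DecidableEq κ] {ι : Type*}
    [DecidableEq ι] [Fintype ι] {φ : A →CP B} (hφ : φ.IsContractive)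
    {a : CStarMatrix m m A} {b : CStarMatrix n n A} (hb : 0 ≤ b)
    {X : Matrix (n × κ) (m × ι) A} {δ ε η C N : ℝ} (hε : 0 ≤ ε) (hη : 0 ≤ η)
    (hC : ∀ i j, ‖X i j‖ ≤ C) (hC0 : 0 ≤ C) (h : amp ι a ≤ conj X (amp κ b) + realScalar _ ε)
    (h₁ : ∀ i j k, ‖φ (star (X j i) * (ofMatrix.symm (amp κ b) * X) j k) -
      φ (star (X j i)) * φ ((ofMatrix.symm (amp κ b) * X) j k)‖ ≤ δ)
    (h₂ : ∀ i j k, ‖φ (amp κ b i j * X j k) - φ (amp κ b i j) * φ (X j k)‖ ≤ δ)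
    (hN : N = Fintype.card (m × ι) * (Fintype.card (m × ι) * Fintype.card (n × κ)))
    (hδ : N * (1 + C * Fintype.card (n × κ)) * δ ≤ ε) (hηC : N * (C * C) * η ≤ ε) :
    amp ι (a.map φ) ≤ conj (X.map φ) (amp κ (cutDown (b.map φ) η)) + realScalar _ (3 * ε) := by
  have hbs : IsSelfAdjoint (b.map φ) := isSelfAdjoint_map φ (.of_nonneg hb)
  have ha : IsSelfAdjoint (amp κ b) := .of_nonneg (amp_nonneg hb)
  -- The three errors come from the image of `ε`, the defect of multiplicativity, and the cut-down
  -- by `η`.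
  have e1 : amp ι (a.map φ) ≤ (conj X (amp κ b)).map φ + realScalar _ ε := by
    rw [← map_amp]
    refine (map_le_map φ h).trans ?_
    rw [map_add_map]
    gcongr
    exact hφ.map_realScalar_le hε
  have e2 : (conj X (amp κ b)).map φ ≤ conj (X.map φ) (amp κ (b.map φ)) + realScalar _ ε := by
    rw [← map_amp]
    refine le_add_realScalar_of_norm_sub_le ?_ ((norm_map_conj_sub_le hφ hC hC0 h₁ h₂).trans ?_)
    · exact (isSelfAdjoint_map φ (isSelfAdjoint_conj X ha)).sub
        (isSelfAdjoint_conj _ (isSelfAdjoint_map φ ha))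
    · refine le_trans (le_of_eq ?_) hδ
      rw [hN]
      ring
  have e3 : conj (X.map φ) (amp κ (b.map φ)) ≤
      conj (X.map φ) (amp κ (cutDown (b.map φ) η)) + realScalar _ ε := by
    have e4 : amp κ (b.map φ) - realScalar _ η ≤ amp κ (cutDown (b.map φ) η) := by
      rw [← amp_realScalar, ← amp_sub]
      exact amp_mono (le_cutDown_add hbs η)
    have e5 := conj_mono (X.map φ) e4
    rw [conj_sub, conj_realScalar, sub_le_iff_le_add] at e5
    refine e5.trans ?_
    gcongr
    refine smul_gram_le _ hη ?_
    refine (mul_le_mul_of_nonneg_left (norm_gram_map_le hφ hC hC0) hη).trans ?_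
    refine le_trans (le_of_eq ?_) hηC
    rw [hN]
    ring
  calc amp ι (a.map φ) ≤ (conj X (amp κ b)).map φ + realScalar _ ε := e1
    _ ≤ conj (X.map φ) (amp κ (b.map φ)) + realScalar _ ε + realScalar _ ε := by gcongr
    _ ≤ conj (X.map φ) (amp κ (cutDown (b.map φ) η)) + realScalar _ ε + realScalar _ ε +
        realScalar _ ε := by gcongr
    _ = _ := by
      rw [add_assoc, add_assoc, ← realScalar_add, ← realScalar_add]
      congr 2
      ring

/-- An asymptotically multiplicative sequence of contractive completely positive maps eventually
preserves an inequality `s ≤ w⋆ (t - η) w + r`, up to an arbitrarily small error. -/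
theorem eventually_map_le [DecidableEq m] [DecidableEq n] {β : ℕ → (B →CP A)}
    (hβ : ∀ k, (β k).IsContractive)
    (hmul : ∀ x y : B, Tendsto (fun k => ‖β k (x * y) - β k x * β k y‖) atTop (𝓝 0))
    {s : CStarMatrix m m B} {t : CStarMatrix n n B} (ht : IsSelfAdjoint t) {w : Matrix n m B}
    {η r ε : ℝ} (hη : 0 ≤ η) (hr : 0 ≤ r) (hε : 0 < ε)
    (h : s ≤ conj w (t - realScalar _ η) + realScalar _ r) :
    ∀ᶠ k in atTop, s.map (β k) ≤
      conj (w.map (β k)) (t.map (β k) - realScalar _ η) + realScalar _ (r + ε) := by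
  obtain ⟨C, hC0, hC⟩ := w.exists_norm_le
  set N : ℝ := Fintype.card m * (Fintype.card m * Fintype.card n) with hN
  -- The first summand covers the compression of `t`, the second the term `η w⋆ w`.
  obtain ⟨δ, hδ0, hδ⟩ := exists_pos_mul_lt hε (N * (1 + C * Fintype.card n) + η * N)
  have ev : ∀ x y : B, ∀ᶠ k in atTop, ‖β k (x * y) - β k x * β k y‖ ≤ δ := fun x y =>
    (hmul x y).eventually_le_const hδ0
  have ev₁ : ∀ᶠ k in atTop, ∀ (i : m) (j : n) (l : m),
      ‖β k (star (w j i) * (ofMatrix.symm t * w) j l) -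
        β k (star (w j i)) * β k ((ofMatrix.symm t * w) j l)‖ ≤ δ :=
    eventually_all.2 fun i => eventually_all.2 fun j => eventually_all.2 fun l => ev _ _
  have ev₂ : ∀ᶠ k in atTop, ∀ (i : n) (j : n) (l : m),
      ‖β k (t i j * w j l) - β k (t i j) * β k (w j l)‖ ≤ δ :=
    eventually_all.2 fun i => eventually_all.2 fun j => eventually_all.2 fun l => ev _ _
  have ev₃ : ∀ᶠ k in atTop, ∀ (i : m) (j : n) (l : m),
      ‖β k (star (w j i) * w j l) - β k (star (w j i)) * β k (w j l)‖ ≤ δ :=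
    eventually_all.2 fun i => eventually_all.2 fun j => eventually_all.2 fun l => ev _ _
  filter_upwards [ev₁, ev₂, ev₃] with k h₁ h₂ h₃
  have e1 := norm_map_conj_sub_le (hβ k) hC hC0 h₁ h₂
  have e2 := norm_map_gram_sub_le h₃
  have e3 := map_le_map (β k) h
  -- As `β k` need not be unital, `η` is rewritten as `η w⋆ w` before mapping; multiplicativity on
  -- `w⋆ w` then avoids `β k 1`.
  rw [conj_sub, conj_realScalar, map_add_map, map_sub_map, map_real_smul_map] at e3
  have hgs : IsSelfAdjoint (gram w) := .of_nonneg (gram_nonneg w)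
  have e4 : (conj w t).map (β k) - η • (gram w).map (β k) ≤
      (conj (w.map (β k)) (t.map (β k)) - η • gram (w.map (β k))) + realScalar _ ε := by
    refine le_add_realScalar_of_norm_sub_le ?_ ?_
    · refine IsSelfAdjoint.sub (IsSelfAdjoint.sub ?_ ?_) (IsSelfAdjoint.sub ?_ ?_)
      · exact isSelfAdjoint_map _ (isSelfAdjoint_conj _ ht)
      · exact (IsSelfAdjoint.all η).smul (isSelfAdjoint_map _ hgs)
      · exact isSelfAdjoint_conj _ (isSelfAdjoint_map _ ht)
      · exact (IsSelfAdjoint.all η).smul (.of_nonneg (gram_nonneg _))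
    · rw [sub_sub_sub_comm, ← smul_sub]
      refine (norm_sub_le _ _).trans ((add_le_add e1 ((norm_smul_le_of_nonneg hη _).trans
        (mul_le_mul_of_nonneg_left e2 hη))).trans (le_trans (le_of_eq ?_) hδ.le))
      rw [hN]
      ring
  rw [conj_sub, conj_realScalar]
  refine e3.trans ((add_le_add e4 ((hβ k).map_realScalar_le hr)).trans (le_of_eq ?_))
  rw [add_comm r, realScalar_add, add_assoc]

/-- The image of `a ≤ ‖a‖ · 1`. It puts the `γ`-part of a matrix below copies of `γ 1`, the element
known to be small. -/
theorem map_le_norm_smul_scalarDiag [DecidableEq n] (φ : A →CP B) {a : CStarMatrix n n A}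
    (ha : 0 ≤ a) : a.map φ ≤ ‖a‖ • scalarDiag n (φ 1) := by
  have h := map_le_map φ (le_realScalar_of_norm_le (.of_nonneg ha) le_rfl)
  refine h.trans (le_of_eq ?_)
  rw [realScalar_eq_diagonal]
  refine ext fun i j => ?_
  change φ (Matrix.diagonal (fun _ => realScalar A ‖a‖) i j) =
    ‖a‖ • (Matrix.diagonal (fun _ => φ 1) i j)
  rw [Matrix.diagonal_apply, Matrix.diagonal_apply, realScalar_eq_smul]
  split_ifs
  · rw [map_smul, Complex.coe_smul]
  · rw [map_zero, smul_zero]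

end CompletelyPositiveMap

namespace CStarMatrix

theorem CuntzLE.scalarDiag [DecidableEq n] {c d : A} (h : CuntzSubequiv c d) :
    CuntzLE (scalarDiag n c) (scalarDiag n d) := by
  have hc : Continuous fun y : A => (Matrix.diagonal fun _ : n => y) := by fun_prop
  refine map_mem_closure (f := fun y : A => (Matrix.diagonal fun _ : n => y)) hc
    ((cuntzSubequiv_iff_mem_closure c d).1 h) ?_
  rintro _ ⟨x, rfl⟩
  refine ⟨Matrix.diagonal fun _ => x, ?_⟩
  change (Matrix.diagonal fun _ : n => x)ᴴ * (Matrix.diagonal fun _ : n => d) *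
    (Matrix.diagonal fun _ : n => x) = _
  rw [Matrix.diagonal_conjTranspose, Matrix.diagonal_mul_diagonal, Matrix.diagonal_mul_diagonal]
  rfl

end CStarMatrix

end Approximation

/-! ### Comparison up to a small remainder, and its absorption. -/

section Main

variable {A : Type u} [CStarAlgebra A] [PartialOrder A] [StarOrderedRing A]

/-- Tracial approximation in the class `𝒲`, with unital C⋆-algebras in place of C⋆-algebras that
have a unit element. -/
theorem AsymptoticallyTraciallyIn.exists_unital (hW : AsymptoticallyTraciallyIn A ClassW.{v})
    {F : Set A} (hF : F.Finite) {ε : ℝ} (hε : 0 < ε) {d : A} (hd : 0 ≤ d) (hd0 : d ≠ 0) :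
    ∃ (B : Type v) (_ : CStarAlgebra B) (_ : PartialOrder B) (_ : StarOrderedRing B)
      (α : A →CP B) (β : ℕ → (B →CP A)) (γ : ℕ → (A →CP A)),
      AlmostUnperforatedCuntzSemigroup B ∧ α.IsContractive ∧ (∀ n, (β n).IsContractive) ∧
      (∀ x ∈ F, ∀ n, ‖x - (γ n x + β n (α x))‖ < ε) ∧
      (∀ x ∈ F, ∀ y ∈ F, ‖α (x * y) - α x * α y‖ < ε) ∧
      (∀ x y : B, Tendsto (fun n => ‖β n (x * y) - β n x * β n y‖) atTop (𝓝 0)) ∧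
      ∀ n, CuntzSubequiv (γ n 1) d := by
  obtain ⟨B, i, po, so, α, β, γ, ⟨⟨e, he⟩, hB⟩, hα, hβ, -, h₁, h₂, h₃, -, h₄⟩ :=
    hW hF.toFinset ε hε d hd hd0
  obtain ⟨j, rfl⟩ := exists_cstarAlgebra_of_unit e he
  rw [hF.coe_toFinset] at h₂
  exact ⟨B, j, po, so, α, β, γ, hB, hα, hβ, fun x hx => h₁ x (hF.mem_toFinset.2 hx), h₂.1, h₃, h₄⟩

namespace CStarMatrix

open CompletelyPositiveMap

variable {p q : ℕ}

theorem norm_sub_map_le {n : Type*} [Fintype n] {a : CStarMatrix n n A} {ψ : A → A} {δ : ℝ}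
    (h : ∀ i j, ‖a i j - ψ (a i j)‖ ≤ δ) :
    ‖a - a.map ψ‖ ≤ Fintype.card n * (Fintype.card n * δ) :=
  norm_le_card_mul fun i j => h i j

/-- If `A` is asymptotically tracially in `𝒲` and `(K + 1)⟨a⟩ ≤ K⟨b⟩`, then `a` is subequivalent to
`b` plus an arbitrarily small remainder. -/
theorem CuntzLE.scalarDiag_dirSum (hW : AsymptoticallyTraciallyIn A ClassW.{v})
    {a : CStarMatrix (Fin p) (Fin p) A} (ha : 0 ≤ a) {b : CStarMatrix (Fin q) (Fin q) A}
    (hb : 0 ≤ b) {K : ℕ} (hK : 1 ≤ K) (h : CuntzLE (amp (Fin (K + 1)) a) (amp (Fin K) b))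
    {d : A} (hd : 0 ≤ d) (hd0 : d ≠ 0) :
    CuntzLE a (dirSum (CStarMatrix.scalarDiag (Fin p) d) b) := by
  refine CuntzLE.of_forall_le_add ha fun ε₀ hε₀ => ?_
  -- The passage to `B` costs `3ε`, doubled to `6ε` by the cancellation there; the return by `β` and
  -- the approximation of `a` cost `ε` each.
  obtain ⟨ε, hε, rfl⟩ : ∃ ε > 0, 8 * ε = ε₀ := ⟨ε₀ / 8, by positivity, by ring⟩
  obtain ⟨X, hX⟩ := cuntzLE_iff.1 h ε hε
  have has : IsSelfAdjoint a := .of_nonneg ha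
  have hbs : IsSelfAdjoint b := .of_nonneg hb
  have hX' : amp (Fin (K + 1)) a ≤ conj X (amp (Fin K) b) + realScalar _ ε :=
    le_add_realScalar_of_norm_sub_le ((IsSelfAdjoint.of_nonneg (amp_nonneg ha)).sub
      (isSelfAdjoint_conj X (.of_nonneg (amp_nonneg hb)))) hX.le
  obtain ⟨C, hC0, hC⟩ := X.exists_norm_le
  set N : ℝ := Fintype.card (Fin p × Fin (K + 1)) *
    (Fintype.card (Fin p × Fin (K + 1)) * Fintype.card (Fin q × Fin K)) with hN
  obtain ⟨η, hη0, hη⟩ := exists_pos_mul_lt hε (N * (C * C))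
  obtain ⟨δ₁, hδ₁0, hδ₁⟩ := exists_pos_mul_lt hε (N * (1 + C * Fintype.card (Fin q × Fin K)))
  obtain ⟨δ₂, hδ₂0, hδ₂⟩ := exists_pos_mul_lt hε ((p : ℝ) * p)
  -- This tolerance is measured against `η`, not `ε`: the approximation of `b` has to be absorbed by
  -- the cut-down.
  obtain ⟨δ₃, hδ₃0, hδ₃⟩ := exists_pos_mul_lt hη0 ((q : ℝ) * q)
  set δ := min δ₁ (min δ₂ δ₃) with hδ
  have hδ0 : 0 < δ := lt_min hδ₁0 (lt_min hδ₂0 hδ₃0)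
  have l₁ : δ ≤ δ₁ := min_le_left _ _
  have l₂ : δ ≤ δ₂ := (min_le_right _ _).trans (min_le_left _ _)
  have l₃ : δ ≤ δ₃ := (min_le_right _ _).trans (min_le_right _ _)
  let T : Matrix (Fin q × Fin K) (Fin p × Fin (K + 1)) A := ofMatrix.symm (amp (Fin K) b) * X
  -- Entries of `a` and `b` for the approximation; the others are the factors of the products in `X⋆
  -- ((b ⊗ 1) X)` and `(b ⊗ 1) X`.
  let F : Set A := (Set.range fun x : Fin p × Fin p => a x.1 x.2) ∪
    (Set.range fun x : Fin q × Fin q => b x.1 x.2) ∪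
    (Set.range fun x : (Fin q × Fin K) × (Fin q × Fin K) => amp (Fin K) b x.1 x.2) ∪
    (Set.range fun x : (Fin q × Fin K) × (Fin p × Fin (K + 1)) => X x.1 x.2) ∪
    (Set.range fun x : (Fin q × Fin K) × (Fin p × Fin (K + 1)) => star (X x.1 x.2)) ∪
    (Set.range fun x : (Fin q × Fin K) × (Fin p × Fin (K + 1)) => T x.1 x.2)
  have hF : F.Finite := by
    refine Set.Finite.union (Set.Finite.union (Set.Finite.union (Set.Finite.union
      (Set.Finite.union ?_ ?_) ?_) ?_) ?_) ?_ <;> exact Set.finite_range _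
  have Fa : ∀ i j, a i j ∈ F := fun i j => .inl (.inl (.inl (.inl (.inl ⟨(i, j), rfl⟩))))
  have Fb : ∀ i j, b i j ∈ F := fun i j => .inl (.inl (.inl (.inl (.inr ⟨(i, j), rfl⟩))))
  have Fab : ∀ i j, amp (Fin K) b i j ∈ F := fun i j => .inl (.inl (.inl (.inr ⟨(i, j), rfl⟩)))
  have FX : ∀ i j, X i j ∈ F := fun i j => .inl (.inl (.inr ⟨(i, j), rfl⟩))
  have FsX : ∀ i j, star (X i j) ∈ F := fun i j => .inl (.inr ⟨(i, j), rfl⟩)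
  have FT : ∀ i j, T i j ∈ F := fun i j => .inr ⟨(i, j), rfl⟩
  obtain ⟨B, _, _, _, α, β, γ, hB, hα, hβ, happ, hmul, hβmul, hγ⟩ :=
    hW.exists_unital hF hδ0 hd hd0
  have s₁ := hα.amp_map_le (a := a) (b := b) hb (δ := δ) (N := N) hε.le hη0.le hC hC0 hX'
    (fun i j k => (hmul _ (FsX _ _) _ (FT _ _)).le) (fun i j k => (hmul _ (Fab _ _) _ (FX _ _)).le)
    hN ((mul_le_mul_of_nonneg_left l₁ (by positivity)).trans hδ₁.le) hη.le
  obtain ⟨w, hw⟩ := exists_le_conj_of_almostUnperforated hB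
    (a := a.map α) (α.map_cstarMatrix_nonneg a ha) (isSelfAdjoint_map α hbs) (by positivity) hK s₁
  -- One index suffices, since the approximation and the smallness of `γ` hold for every index.
  obtain ⟨k, hk⟩ := (eventually_map_le hβ hβmul (isSelfAdjoint_map α hbs) hη0.le
    (by positivity) hε hw).exists
  have sa : ∀ {n : ℕ} {x : CStarMatrix (Fin n) (Fin n) A}, IsSelfAdjoint x →
      IsSelfAdjoint (x.map (γ k) + (x.map α).map (β k)) := fun hx =>
    (isSelfAdjoint_map _ hx).add (isSelfAdjoint_map _ (isSelfAdjoint_map _ hx))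
  have u₁ : a ≤ a.map (γ k) + (a.map α).map (β k) + realScalar _ ε := by
    refine le_add_realScalar_of_norm_sub_le (has.sub (sa has)) ?_
    refine (norm_sub_map_le (ψ := fun x => γ k x + β k (α x))
      fun i j => (happ _ (Fa i j) k).le).trans ?_
    rw [Fintype.card_fin, ← mul_assoc]
    exact (mul_le_mul_of_nonneg_left l₂ (by positivity)).trans hδ₂.le
  -- The positive summand `γ_k(b)` is dropped, and `η` covers the approximation error.
  have u₂ : (b.map α).map (β k) - realScalar _ η ≤ b := by
    have e : b.map (γ k) + (b.map α).map (β k) ≤ b + realScalar _ η := by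
      refine le_add_realScalar_of_norm_sub_le ((sa hbs).sub hbs) ?_
      rw [norm_sub_rev]
      refine (norm_sub_map_le (ψ := fun x => γ k x + β k (α x))
        fun i j => (happ _ (Fb i j) k).le).trans ?_
      rw [Fintype.card_fin, ← mul_assoc]
      exact (mul_le_mul_of_nonneg_left l₃ (by positivity)).trans hδ₃.le
    rw [sub_le_iff_le_add]
    exact (le_add_of_nonneg_left ((γ k).map_cstarMatrix_nonneg _ hb)).trans e
  have aγ : 0 ≤ a.map (γ k) := (γ k).map_cstarMatrix_nonneg _ ha
  refine ⟨a.map (γ k) + conj (w.map (β k)) b, ?_, ?_⟩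
  · refine (CuntzLE.add_dirSum _ _).trans (CuntzLE.dirSum_le_dirSum ?_ (CuntzLE.of_conj _ _))
    exact (CuntzLE.of_le_smul aγ (norm_nonneg a) (map_le_norm_smul_scalarDiag (γ k) ha)).trans
      (CuntzLE.scalarDiag (hγ k))
  · calc a ≤ a.map (γ k) + (a.map α).map (β k) + realScalar _ ε := u₁
      _ ≤ a.map (γ k) + (conj (w.map (β k)) b + realScalar _ (2 * (3 * ε) + ε)) +
          realScalar _ ε := by
        gcongr
        refine hk.trans ?_
        gcongr
        exact conj_mono _ u₂
      _ = _ := by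
        rw [← add_assoc, add_assoc, ← realScalar_add]
        congr 2
        ring

/-- A simple unital C⋆-algebra which is asymptotically tracially in `𝒲` has an almost unperforated
Cuntz semigroup. -/
theorem almostUnperforated_of_asymptoticallyTraciallyIn (hA : IsSimpleCStarAlgebra A)
    (hW : AsymptoticallyTraciallyIn A ClassW.{v}) : AlmostUnperforatedCuntzSemigroup A := by
  rw [almostUnperforated_iff]
  intro p q a b ha hb k hk hab
  by_cases hb0 : b = 0
  · subst hb0
    -- Here `⟨a⟩ ≤ (k+1)⟨a⟩ ≤ k⟨0⟩ ≤ ⟨0⟩`.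
    have h0 : CuntzLE (amp (Fin k) (0 : CStarMatrix (Fin q) (Fin q) A))
        (0 : CStarMatrix (Fin q) (Fin q) A) := by
      have e : amp (Fin k) (0 : CStarMatrix (Fin q) (Fin q) A) = 0 := Matrix.blockDiagonal_zero
      rw [e]
      exact subset_closure ⟨0, Matrix.mul_zero _⟩
    have h1 := (nsmul_cuntzClass_le_iff (ha := ha) (hb := hb).2 hab).trans
      (nsmul_cuntzClass_le_cuntzClass_iff (hb := hb).2 h0)
    rw [succ_nsmul] at h1
    exact cuntzClass_le_iff.1
      ((le_add_of_nonneg_left (nsmul_nonneg (zero_le_cuntzClass a ha) k)).trans h1)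
  by_cases hD : ∃ P : CStarMatrix (Fin q) (Fin q) A, IsMinimalProjection P
  · obtain ⟨P, hP⟩ := hD
    obtain ⟨p₀, hp₀⟩ := hP.of_cstarMatrix
    exact almostUnperforated_iff.1 (hp₀.almostUnperforated hA) p q a b ha hb k hk hab
  -- Doubling the hypothesis leaves a gap of two, `(2k+2)⟨a⟩ ≤ 2k⟨b⟩`. Passing to `b₁` costs one,
  -- and a gap of one remains.
  obtain ⟨b₁, c, hb₁, hc, hc0, hsum, hle⟩ := exists_room hA hD (2 * k) hb hb0
  -- The remainder consists of `p` copies of `d`, one for each row of `a`.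
  obtain ⟨d, hd, hd0, hdc⟩ := exists_scalarDiag_le hA hD p hc hc0
  have h1 : (2 * k + 1 + 1) • cuntzClass a ha ≤ (2 * k + 1) • cuntzClass b₁ hb₁ := by
    refine le_trans ?_ hle
    have h2 := nsmul_le_nsmul_right (nsmul_cuntzClass_le_iff (ha := ha) (hb := hb).2 hab) 2
    rw [smul_smul, smul_smul] at h2
    exact h2
  have h2 := CuntzLE.scalarDiag_dirSum hW ha hb₁ (Nat.le_add_left 1 (2 * k))
    (nsmul_cuntzClass_le_iff.1 h1) hd hd0
  have h3 : cuntzClass a ha ≤ cuntzClass c hc + cuntzClass b₁ hb₁ :=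
    cuntzClass_le_add_iff.2 (h2.trans (CuntzLE.dirSum_le_dirSum hdc (CuntzLE.refl b₁)))
  rw [add_comm] at h3
  exact cuntzClass_le_iff.1 (h3.trans hsum)

end CStarMatrix

end Main

theorem mainTheorem11 (A : Type u) [CStarAlgebra A] [PartialOrder A] [StarOrderedRing A]
    (hA : IsSimpleCStarAlgebra A) (hW : AsymptoticallyTraciallyIn A ClassW.{v}) :
    ClassW A :=
  ⟨⟨1, fun x => ⟨one_mul x, mul_one x⟩⟩,
    CStarMatrix.almostUnperforated_of_asymptoticallyTraciallyIn hA hW⟩
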